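/- Let $\mathbb K\in\{\mathbb R,\mathbb C\}$, $A,B,C,D,E\in\mathbb K^{n\times n}$, and consider the quartic matrix polynomial $\lambda^4A+\lambda^3B+\lambda^2C+\lambda D+E$ with the $4n\times 4n$ linearization $$\mathbb A-\lambda\mathbb B=\begin{pmatrix}B&0&-I_n&0\\D&0&0&-I_n\\0&-I_n&0&0\\E&0&0&0\end{pmatrix}-\lambda\begin{pmatrix}-A&0&0&0\\-C&-I_n&0&0\\0&0&-I_n&0\\0&0&0&-I_n\end{pmatrix}.$$ All computations are done in floating point arithmetic in which every basic operation has relative error at most $\varepsilon$ (standard model). Let the Householder QR factorization with Businger--Golub column pivoting (in every step the pivot column has the largest computed norm of the remaining columns, restricted to the remaining rows) be applied to $E$; let $\widetilde\Pi_E$ be the resulting permutation, $R$ the computed $n\times n$ upper triangular factor and $\widetilde Q_E$ the explicitly formed computed unitary factor. Let $\tau$ be a threshold and $\widetilde r_E$ a numerical rank determined from a drop-off on the diagonal of $R$: $R_{ii}\ne0$ for $i\le \widetilde r_E$, and $|R_{\widetilde r_E+1,\widetilde r_E+1}|\le\tau|R_{\widetilde r_E,\widetilde r_E}|$ if $1\le\widetilde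 r_E<n$; $\widetilde r_E=0$ only if $n=0$ or $R_{11}=0$. Let $\widetilde R_E$ be the first $\widetilde r_E$ rows of $R$, so that $E\widetilde\Pi_E\approx\widetilde Q_E\left(\begin{smallmatrix}\widetilde R_E\\0\end{smallmatrix}\right)$. Let $\widetilde X=\mathrm{computed}(\widetilde Q_E^*D)$ and $\widetilde Y=\mathrm{computed}(\widetilde Q_E^*C)$, computed either by matrix multiplication with $\widetilde Q_E$ or by applying the stored Householder reflectors, and let $$\widetilde{\mathbb A}_{22}-\lambda\widetilde{\mathbb B}_{22}=\begin{pmatrix}B&0&-I_n&0\\ \widetilde X&0&0&-\left(\begin{smallmatrix}I_{\widetilde r_E}\\0\end{smallmatrix}\right)\\0&-I_n&0&0\\ \widetilde R_E\widetilde\Pi_E^T&0&0&0\end{pmatrix}-\lambda\begin{pmatrix}-A&0&0&0\\-\widetilde Y&-\widetilde Q_E^*&0&0\\0&0&-I_n&0\\0&0&0&-I_{\widetilde r_E}\end{pmatrix}$$ be the computed reduced pencil of order $3n+\widetilde r_E$. There is a constant $c>0$, independent of $n$, $\varepsilon$, $\tau$ and of all data, such that the following holds whenever $c\,n^3\varepsilon\le1$.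 Put $\epsilon=c\,n^3\varepsilon$. There exist $\delta Q_E,\delta C,\delta D,\delta E,\Delta E\in\mathbb K^{n\times n}$ such that, with $\delta\widetilde{\mathbb B}_{22}$ denoting the matrix whose only nonzero block is $-\delta Q_E^*$ at block position $(2,2)$, the pencil $\widetilde{\mathbb A}_{22}-\lambda(\widetilde{\mathbb B}_{22}+\delta\widetilde{\mathbb B}_{22})$ is an exact reduced linearization of $$\lambda^4A+\lambda^3B+\lambda^2(C+\delta C)+\lambda(D+\delta D)+(E+\delta E+\Delta E).$$ That is: $\widehat Q_E=\widetilde Q_E+\delta Q_E$ is exactly unitary, $\widetilde R_E$ is upper trapezoidal, $(E+\delta E+\Delta E)\widetilde\Pi_E=\widehat Q_E\left(\begin{smallmatrix}\widetilde R_E\\0\end{smallmatrix}\right)$ has rank exactly $\widetilde r_E$, and, if $\mathbb A'-\lambda\mathbb B'$ is the linearization above formed with the perturbed coefficients, then $$\mathrm{diag}(I_n,\widehat Q_E^*,I_n,\widehat Q_E^*)\,(\mathbb A'-\lambda\mathbb B')\,\mathrm{diag}(I_n,I_n,I_n,\widehat Q_E)=\begin{pmatrix}\widetilde{\mathbb A}_{22}-\lambda(\widetilde{\mathbb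 B}_{22}+\delta\widetilde{\mathbb B}_{22})&\ast\\0&\lambda I_{n-\widetilde r_E}\end{pmatrix}.$$ The perturbed quartic polynomial has at least $n-\widetilde r_E$ zero eigenvalues: $\lambda^{n-\widetilde r_E}$ divides its determinant, and $E+\delta E+\Delta E$ has a null space of dimension at least $n-\widetilde r_E$. Moreover $\|\delta Q_E\|_F\le\epsilon$, for all $i=1,\dots,n$ $$\|\delta C(:,i)\|_2\le\epsilon\|C(:,i)\|_2,\quad\|\delta D(:,i)\|_2\le\epsilon\|D(:,i)\|_2,\quad\|\delta E(:,i)\|_2\le\epsilon\|E(:,i)\|_2,$$ and, with $k=\widetilde r_E$, the truncation error satisfies $(\Delta E)\widetilde\Pi_E(:,1:k)=0$ and $$\|(\Delta E)\widetilde\Pi_E(:,j)\|_2\le(1+\epsilon)\,\tau\,\|(E+\delta E)\widetilde\Pi_E(:,i)\|_2\qquad(1\le i\le k<j\le n),$$ where the factor $1+\epsilon$ can be replaced by $1$ if the computed $R$ satisfies the Businger--Golub dominance $|R_{ii}|^2\ge\sum_{l=i}^{j}|R_{lj}|^2$ ($i\le j$) exactly. If $k=0$, then $\Delta E=0$. 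-/

import Mathlib

open scoped Polynomial

/-! ### Floating point arithmetic -/

/-- Standard model of floating point arithmetic: `y` is an admissible computed value of the exact
result `x` of one basic operation, i.e. its relative error is at most `ε`. -/
def Fl {K : Type*} [NormedRing K] (ε : ℝ) (x y : K) : Prop := ‖y - x‖ ≤ ε * ‖x‖

/-- `FlSum ε f s c`: `c` is an admissible computed value of the sum of `f` over the nonempty finite
set `s`, where the additions are carried out in an arbitrary order (recursive, pairwise,
blocked, ...). -/
inductive FlSum {ι K : Type*} [NormedRing K] (ε : ℝ) (f : ι → K) : Finset ι → K → Prop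
  | single (i : ι) : FlSum ε f {i} (f i)
  | add {s t : Finset ι} {a b c : K} (hst : Disjoint s t) (hs : FlSum ε f s a)
      (ht : FlSum ε f t b) (hc : Fl ε (a + b) c) : FlSum ε f (s.disjUnion t hst) c

/-- `c` is an admissible computed value of the sum of `a i * b i` over `i ∈ s`. -/
def FlDot {ι K : Type*} [NormedRing K] (ε : ℝ) (s : Finset ι) (a b : ι → K) (c : K) : Prop :=
  ∃ p : ι → K, (∀ i ∈ s, Fl ε (a i * b i) (p i)) ∧ FlSum ε p s c

/-- `ν` is an admissible computed value of the Euclidean norm of the entries `x i`, `i ∈ s`. -/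
def FlNorm {ι 𝕜 : Type*} [RCLike 𝕜] (ε : ℝ) (s : Finset ι) (x : ι → 𝕜) (ν : ℝ) : Prop :=
  ∃ (q : ι → ℝ) (t : ℝ), (∀ i ∈ s, Fl ε (‖x i‖ ^ 2) (q i)) ∧ FlSum ε q s t ∧ Fl ε (Real.sqrt t) ν

/-! ### Householder QR factorization with column pivoting in floating point arithmetic -/

section Householder

variable {𝕜 : Type*} [RCLike 𝕜] {n : ℕ}

/-- Computation of a Householder reflector `H = I - β v v^*` that acts on the rows `k, k+1, ...` and
maps (in exact arithmetic) the rows `k, k+1, ...` of `x` to `(-σ, 0, ..., 0)`, where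
`σ = (x k / |x k|) ‖x(k:n)‖`, `v = x(k:n) + σ e_k` and `β = 1 / (‖x(k:n)‖ (‖x(k:n)‖ + |x k|))`.
Here `ν` is the already computed norm of `x(k:n)`. -/
def FlReflector (ε : ℝ) (k : Fin n) (x : Fin n → 𝕜) (ν : ℝ) (σ : 𝕜) (v : Fin n → 𝕜) (β : ℝ) :
    Prop :=
  (ν = 0 → σ = 0 ∧ v = 0 ∧ β = 0) ∧
  (ν ≠ 0 →
    (∀ i, i < k → v i = 0) ∧ (∀ i, k < i → v i = x i) ∧ Fl ε (x k + σ) (v k) ∧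
    ∃ (a : ℝ) (φ : 𝕜) (d b : ℝ),
      Fl ε ‖x k‖ a ∧
      (x k = 0 → φ = 1) ∧ (x k ≠ 0 → Fl ε (x k / (a : 𝕜)) φ) ∧
      Fl ε (φ * (ν : 𝕜)) σ ∧
      Fl ε (ν + a) d ∧ Fl ε (ν * d) b ∧ Fl ε (1 / b) β)

/-- `y'` is an admissible computed value of `(I - β v v^*) y`, evaluated on the rows `k, k+1, ...`
as `y - v (β (v^* y))`; the rows above row `k` are not touched. -/
def FlReflect (ε : ℝ) (k : Fin n) (v : Fin n → 𝕜) (β : ℝ) (y y' : Fin n → 𝕜) : Prop :=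
  (∀ i, i < k → y' i = y i) ∧
  ∃ w g : 𝕜, FlDot ε (Finset.Ici k) (fun i => star (v i)) y w ∧ Fl ε ((β : 𝕜) * w) g ∧
    ∀ i, k ≤ i → ∃ p : 𝕜, Fl ε (v i * g) p ∧ Fl ε (y i - p) (y' i)

/-- Householder QR factorization with (Businger--Golub) column pivoting of `E`, in floating point
arithmetic. The column interchanges are collected in the permutation `π`: column `j` of `E Π` is
column `π j` of `E`. In step `k` the pivot column `k` has the largest computed norm of all
remaining columns (restricted to the rows `k, k+1, ...`). `W k` is the working array before step
`k`, the reflectors are given by `v k`, `β k`, and `R` is the final upper triangular array. -/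
def IsPivotedQR (ε : ℝ) (E : Matrix (Fin n) (Fin n) 𝕜) (π : Equiv.Perm (Fin n))
    (v : Fin n → Fin n → 𝕜) (β : Fin n → ℝ) (R : Matrix (Fin n) (Fin n) 𝕜) : Prop :=
  ∃ (W : ℕ → Matrix (Fin n) (Fin n) 𝕜) (ν : Fin n → Fin n → ℝ) (σ : Fin n → 𝕜),
    W 0 = E.submatrix id π ∧ W n = R ∧
    ∀ k : Fin n,
      (∀ j, k ≤ j → FlNorm ε (Finset.Ici k) (fun i => W k i j) (ν k j)) ∧
      (∀ j, k ≤ j → ν k j ≤ ν k k) ∧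
      FlReflector ε k (fun i => W k i k) (ν k k) (σ k) (v k) (β k) ∧
      (∀ j, j < k → ∀ i, W (k + 1) i j = W k i j) ∧
      (∀ i, W (k + 1) i k = if i < k then W k i k else if i = k then -σ k else 0) ∧
      (∀ j, k < j → FlReflect ε k (v k) (β k) (fun i => W k i j) (fun i => W (k + 1) i j))

/-- `Q` is the explicitly formed computed unitary factor: the reflectors are accumulated backwards,
`Q = H_1 (H_2 (... (H_n I)))`. -/
def IsFormedQ (ε : ℝ) (v : Fin n → Fin n → 𝕜) (β : Fin n → ℝ) (Q : Matrix (Fin n) (Fin n) 𝕜) :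
    Prop :=
  ∃ G : ℕ → Matrix (Fin n) (Fin n) 𝕜, G n = 1 ∧ G 0 = Q ∧
    ∀ k j : Fin n, FlReflect ε k (v k) (β k) (fun i => G (k + 1) i j) (fun i => G k i j)

/-- `X` is computed as `Q^* D` by matrix multiplication with the explicitly formed `Q`. -/
def IsMatMulProduct (ε : ℝ) (Q D X : Matrix (Fin n) (Fin n) 𝕜) : Prop :=
  ∀ i j, FlDot ε Finset.univ (fun l => star (Q l i)) (fun l => D l j) (X i j)

/-- `X` is computed as `Q^* D = H_n (... (H_2 (H_1 D)))` by applying the stored reflectors. -/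
def IsReflectorProduct (ε : ℝ) (v : Fin n → Fin n → 𝕜) (β : Fin n → ℝ)
    (D X : Matrix (Fin n) (Fin n) 𝕜) : Prop :=
  ∃ Z : ℕ → Matrix (Fin n) (Fin n) 𝕜, Z 0 = D ∧ Z n = X ∧
    ∀ k j : Fin n, FlReflect ε k (v k) (β k) (fun i => Z k i j) (fun i => Z (k + 1) i j)

/-- `X = computed(Q^* D)`, with `Q` used either explicitly or through its reflectors. -/
def IsComputedProduct (ε : ℝ) (v : Fin n → Fin n → 𝕜) (β : Fin n → ℝ)
    (Q D X : Matrix (Fin n) (Fin n) 𝕜) : Prop :=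
  IsMatMulProduct ε Q D X ∨ IsReflectorProduct ε v β D X

/-- `r` is a numerical rank of the computed triangular factor `R`, with threshold `τ`: the first `r`
diagonal entries do not vanish and, unless `r = n`, there is a drop-off `|R_{r+1,r+1}| ≤ τ |R_{rr}|`
between two consecutive diagonal entries (one-based indices). The value `r = 0` is allowed only if
already the first diagonal entry is zero. -/
def IsNumericalRank (τ : ℝ) (R : Matrix (Fin n) (Fin n) 𝕜) (r : ℕ) : Prop :=
  r ≤ n ∧ (∀ i : Fin n, (i : ℕ) < r → R i i ≠ 0) ∧
  (∀ i j : Fin n, (i : ℕ) + 1 = r → (j : ℕ) = r → ‖R j j‖ ≤ τ * ‖R i i‖) ∧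
  (r = 0 → ∀ j : Fin n, (j : ℕ) = 0 → R j j = 0)

/-- Exact diagonal dominance of Businger--Golub type:
`|R_{ii}| ≥ (∑_{l=i}^{j} |R_{lj}|^2)^{1/2}` for `i ≤ j`. -/
def IsDiagDominant (R : Matrix (Fin n) (Fin n) 𝕜) : Prop :=
  ∀ i j, i ≤ j → ∑ l ∈ Finset.Icc i j, ‖R l j‖ ^ 2 ≤ ‖R i i‖ ^ 2

end Householder

/-! ### The linearization of the quartic polynomial and its first deflation step -/

section Pencils

variable {𝕜 : Type*} [RCLike 𝕜] {n r : ℕ}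

/-- Euclidean norm of column `j`. -/
noncomputable def colNorm (M : Matrix (Fin n) (Fin n) 𝕜) (j : Fin n) : ℝ :=
  Real.sqrt (∑ i, ‖M i j‖ ^ 2)

/-- Frobenius norm. -/
noncomputable def frobNorm (M : Matrix (Fin n) (Fin n) 𝕜) : ℝ :=
  Real.sqrt (∑ i, ∑ j, ‖M i j‖ ^ 2)

/-- The matrix polynomial `λ^4 A + λ^3 B + λ^2 C + λ D + E`. -/
noncomputable def quartic (A B C D E : Matrix (Fin n) (Fin n) 𝕜) : Matrix (Fin n) (Fin n) 𝕜[X] :=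
  (Polynomial.X ^ 4 : 𝕜[X]) • A.map Polynomial.C + (Polynomial.X ^ 3 : 𝕜[X]) • B.map Polynomial.C
    + (Polynomial.X ^ 2 : 𝕜[X]) • C.map Polynomial.C + (Polynomial.X : 𝕜[X]) • D.map Polynomial.C + E.map Polynomial.C

/-- The matrix polynomial `P` has at least `m` zero eigenvalues, counted with algebraic multiplicity
(`λ^m` divides `det P(λ)`) and also counted with geometric multiplicity
(the null space of `P(0)` has dimension at least `m`). -/
def HasAtLeastZeroEigenvalues (m : ℕ) (P : Matrix (Fin n) (Fin n) 𝕜[X]) : Prop :=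
  (Polynomial.X : 𝕜[X]) ^ m ∣ P.det ∧
  m ≤ Module.finrank 𝕜 (LinearMap.ker (Matrix.toLin' (P.map (Polynomial.eval 0))))

/-- The left coefficient `𝔸` of the `4n × 4n` linearization `𝔸 - λ 𝔹`. -/
def linA (B D E : Matrix (Fin n) (Fin n) 𝕜) :
    Matrix ((Fin n ⊕ Fin n) ⊕ (Fin n ⊕ Fin n)) ((Fin n ⊕ Fin n) ⊕ (Fin n ⊕ Fin n)) 𝕜 :=
  Matrix.fromBlocks (Matrix.fromBlocks B 0 D 0) (-1) (Matrix.fromBlocks 0 (-1) E 0) 0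

/-- The right coefficient `𝔹` of the `4n × 4n` linearization `𝔸 - λ 𝔹`. -/
def linB (A C : Matrix (Fin n) (Fin n) 𝕜) :
    Matrix ((Fin n ⊕ Fin n) ⊕ (Fin n ⊕ Fin n)) ((Fin n ⊕ Fin n) ⊕ (Fin n ⊕ Fin n)) 𝕜 :=
  Matrix.fromBlocks (Matrix.fromBlocks (-A) 0 (-C) (-1)) 0 0 (-1)

/-- The left transformation `diag(I, Q^*, I, Q^*)`. -/
def transL (Q : Matrix (Fin n) (Fin n) 𝕜) :
    Matrix ((Fin n ⊕ Fin n) ⊕ (Fin n ⊕ Fin n)) ((Fin n ⊕ Fin n) ⊕ (Fin n ⊕ Fin n)) 𝕜 :=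
  Matrix.fromBlocks (Matrix.fromBlocks 1 0 0 Q.conjTranspose) 0 0
    (Matrix.fromBlocks 1 0 0 Q.conjTranspose)

/-- The right transformation `diag(I, I, I, Q)`. -/
def transR (Q : Matrix (Fin n) (Fin n) 𝕜) :
    Matrix ((Fin n ⊕ Fin n) ⊕ (Fin n ⊕ Fin n)) ((Fin n ⊕ Fin n) ⊕ (Fin n ⊕ Fin n)) 𝕜 :=
  Matrix.fromBlocks 1 0 0 (Matrix.fromBlocks 1 0 0 Q)

/-- The `n × r` matrix formed by the first `r` columns of the identity. -/
def firstCols (𝕜 : Type*) [RCLike 𝕜] (h : r ≤ n) : Matrix (Fin n) (Fin r) 𝕜 :=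
  (1 : Matrix (Fin n) (Fin n) 𝕜).submatrix id (Fin.castLE h)

/-- The first `r` rows of `R`. -/
def firstRows (h : r ≤ n) (R : Matrix (Fin n) (Fin n) 𝕜) : Matrix (Fin r) (Fin n) 𝕜 :=
  R.submatrix (Fin.castLE h) id

/-- The left coefficient of the reduced pencil of order `3n + r`, with blocks `B`, `X` (in exact
arithmetic `Q^* D`) and `R Π^T`. -/
def redA (h : r ≤ n) (B X : Matrix (Fin n) (Fin n) 𝕜) (R : Matrix (Fin r) (Fin n) 𝕜)
    (π : Equiv.Perm (Fin n)) :
    Matrix ((Fin n ⊕ Fin n) ⊕ (Fin n ⊕ Fin r)) ((Fin n ⊕ Fin n) ⊕ (Fin n ⊕ Fin r)) 𝕜 :=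
  Matrix.fromBlocks (Matrix.fromBlocks B 0 X 0)
    (Matrix.fromBlocks (-1) 0 0 (-firstCols 𝕜 h))
    (Matrix.fromBlocks 0 (-1) (R.submatrix id π.symm) 0) 0

/-- The right coefficient of the reduced pencil of order `3n + r`, with blocks `-A`, `-Y` (in exact
arithmetic `-Q^* C`) and `-Q^*`. -/
def redB (r : ℕ) (A Y Q : Matrix (Fin n) (Fin n) 𝕜) :
    Matrix ((Fin n ⊕ Fin n) ⊕ (Fin n ⊕ Fin r)) ((Fin n ⊕ Fin n) ⊕ (Fin n ⊕ Fin r)) 𝕜 :=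
  Matrix.fromBlocks (Matrix.fromBlocks (-A) 0 (-Y) (-Q.conjTranspose)) 0 0 (-1)

/-- The structured perturbation of the right coefficient: the only nonzero block is `-δQ^*`. -/
def deltaRedB (r : ℕ) (δQ : Matrix (Fin n) (Fin n) 𝕜) :
    Matrix ((Fin n ⊕ Fin n) ⊕ (Fin n ⊕ Fin r)) ((Fin n ⊕ Fin n) ⊕ (Fin n ⊕ Fin r)) 𝕜 :=
  Matrix.fromBlocks (Matrix.fromBlocks 0 0 0 (-δQ.conjTranspose)) 0 0 0

/-- Splitting the `4n` indices into the leading `3n + r` and the trailing `n - r` ones. -/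
def splitIdx (h : r ≤ n) :
    ((Fin n ⊕ Fin n) ⊕ (Fin n ⊕ Fin r)) ⊕ Fin (n - r) ≃ (Fin n ⊕ Fin n) ⊕ (Fin n ⊕ Fin n) :=
  (Equiv.sumAssoc _ _ _).trans ((Equiv.refl _).sumCongr ((Equiv.sumAssoc _ _ _).trans
    ((Equiv.refl _).sumCongr (finSumFinEquiv.trans (finCongr (Nat.add_sub_of_le h))))))

/-- `𝔸₂ - λ 𝔹₂` is an exact reduced linearization, of order `3n + r`, of the quartic polynomial with
coefficients `A, B, C, D, E`: for an exact QR factorization with column permutation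
`E Π = Q (R; 0)`, where `Q` is unitary, `R` is `r × n` upper trapezoidal and `r = rank E`, the
transformed linearization `diag(I, Q^*, I, Q^*) (𝔸 - λ 𝔹) diag(I, I, I, Q)` is block upper
triangular, with leading diagonal block `𝔸₂ - λ 𝔹₂` and with trailing diagonal block
`-λ (-I)` of order `n - r` (which carries the deflated `n - r` zero eigenvalues). -/
def IsExactReducedLinearization (h : r ≤ n) (A B C D E : Matrix (Fin n) (Fin n) 𝕜)
    (π : Equiv.Perm (Fin n)) (Q : Matrix (Fin n) (Fin n) 𝕜) (R : Matrix (Fin r) (Fin n) 𝕜)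
    (A₂ B₂ : Matrix ((Fin n ⊕ Fin n) ⊕ (Fin n ⊕ Fin r)) ((Fin n ⊕ Fin n) ⊕ (Fin n ⊕ Fin r)) 𝕜) :
    Prop :=
  Q ∈ Matrix.unitaryGroup (Fin n) 𝕜 ∧
  (∀ (i : Fin r) (j : Fin n), (j : ℕ) < (i : ℕ) → R i j = 0) ∧
  E.rank = r ∧
  E.submatrix id π = Q * (firstCols 𝕜 h * R) ∧
  ∃ S T : Matrix ((Fin n ⊕ Fin n) ⊕ (Fin n ⊕ Fin r)) (Fin (n - r)) 𝕜,
    (transL Q * linA B D E * transR Q).submatrix (splitIdx h) (splitIdx h)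
      = Matrix.fromBlocks A₂ S 0 0 ∧
    (transL Q * linB A C * transR Q).submatrix (splitIdx h) (splitIdx h)
      = Matrix.fromBlocks B₂ T 0 (-1)

end Pencils

/-! The whole analysis rests on one exactly unitary matrix `P`, the product of exact Householder
reflectors close to the computed ones. Every computed object is compared with this same `P`: the
columns of `P * R` are close to those of `E Π`, the explicitly formed `Q` is close to `P`, and `P *
X`, `P * Y` are close to `D`, `C` whichever way the products were computed
(`IsPivotedQR.exists_unitary`, `IsMatMulProduct.colNorm_sub_le`).

The perturbations are then defined as the resulting defects: `P - Q`, `P * Y - C`, `P * X - D` and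
`P R Πᵀ - E`, while `ΔE` comes from replacing the rows of `R` beyond the numerical rank by zero.
With these coefficients `Pᴴ` cancels `P` exactly, so that the reduction of the pencil, the rank and
the zero eigenvalues are pure algebra (`isExactReducedLinearization_of_unitary`).

The error bounds come from a single reflection with relative error `170 * η`, where `η = 2 n ε`
(`FlReflect.l2_sub_le`, `FlReflector.exists_householder`). Pulling the iterates back by partial
products of unitary matrices turns `n` such steps into a relative error of order `n² ε` in each
column. The last factor `n` pays for passing from entries or columns to norms.

The truncation bound uses pivoting: the computed `R` satisfies Businger--Golub dominance up to a
factor `1 + O(n³ ε)`. Hence the discarded part of a column is controlled by the first discarded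
diagonal entry, this one by the drop-off, and the last retained diagonal entry by every earlier one
(`colNorm_truncation_le`). -/

/-! ### Relative errors of basic operations, sums, inner products and norms -/

section FloatingPoint

namespace Fl

variable {K : Type*} [NormedField K] {h h₁ h₂ : ℝ} {x y z x' y' : K}

theorem mono (H : Fl h₁ x y) (hh : h₁ ≤ h₂) : Fl h₂ x y :=
  le_trans H (mul_le_mul_of_nonneg_right hh (norm_nonneg _))

theorem norm_le (H : Fl h x y) : ‖y‖ ≤ (1 + h) * ‖x‖ := by
  have h1 : ‖y - x‖ ≤ h * ‖x‖ := H
  have h2 : ‖y‖ ≤ ‖x‖ + ‖y - x‖ := by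
    simpa using norm_add_le x (y - x)
  linarith

theorem le_norm (H : Fl h x y) : (1 - h) * ‖x‖ ≤ ‖y‖ := by
  have h1 : ‖y - x‖ ≤ h * ‖x‖ := H
  have h2 : ‖x‖ ≤ ‖y‖ + ‖y - x‖ := by
    simpa using norm_sub_le y (y - x)
  linarith

theorem ne_zero (H : Fl h x y) (hh : h < 1) (hx : x ≠ 0) : y ≠ 0 := by
  have h1 := H.le_norm
  have h2 : 0 < (1 - h) * ‖x‖ := mul_pos (by linarith) (norm_pos_iff.2 hx)
  exact norm_pos_iff.1 (h2.trans_le h1)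

theorem eq_zero (H : Fl h x y) (hx : x = 0) : y = 0 := by
  subst hx
  simpa [Fl] using H

theorem trans (H₁ : Fl h₁ x y) (H₂ : Fl h₂ y z) (hh₂ : 0 ≤ h₂) :
    Fl (h₁ + h₂ + h₁ * h₂) x z := by
  have h1 : ‖y - x‖ ≤ h₁ * ‖x‖ := H₁
  have h2 : ‖z - y‖ ≤ h₂ * ‖y‖ := H₂
  have h3 : ‖z - x‖ ≤ ‖z - y‖ + ‖y - x‖ := by simpa using norm_add_le (z - y) (y - x)
  have h4 := mul_le_mul_of_nonneg_left H₁.norm_le hh₂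
  show ‖z - x‖ ≤ _
  linarith

theorem mul (H₁ : Fl h₁ x x') (H₂ : Fl h₂ y y') (hh₁ : 0 ≤ h₁) :
    Fl (h₁ + h₂ + h₁ * h₂) (x * y) (x' * y') := by
  have h1 : ‖x' - x‖ ≤ h₁ * ‖x‖ := H₁
  have h2 : ‖y' - y‖ ≤ h₂ * ‖y‖ := H₂
  have e : x' * y' - x * y = (x' - x) * y' + x * (y' - y) := by ring
  show ‖x' * y' - x * y‖ ≤ _
  rw [e, norm_mul]
  have h3 := norm_add_le ((x' - x) * y') (x * (y' - y))
  rw [norm_mul, norm_mul] at h3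
  have h4 := mul_le_mul h1 H₂.norm_le (norm_nonneg _) (by positivity)
  have h5 := mul_le_mul_of_nonneg_left h2 (norm_nonneg x)
  linarith

theorem inv (H : Fl h x y) (h0 : 0 ≤ h) (hh : h ≤ 1 / 2) : Fl (2 * h) x⁻¹ y⁻¹ := by
  by_cases hx : x = 0
  · have := H.eq_zero hx
    subst hx this
    simp [Fl]
  have hy := H.ne_zero (by linarith) hx
  have h1 : ‖y - x‖ ≤ h * ‖x‖ := H
  have h2 := H.le_norm
  have hxp := norm_pos_iff.2 hx
  have hyp := norm_pos_iff.2 hy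
  have e : y⁻¹ - x⁻¹ = (x - y) * (x⁻¹ * y⁻¹) := by field_simp
  show ‖y⁻¹ - x⁻¹‖ ≤ _
  rw [e, norm_mul, norm_mul, norm_inv, norm_inv, norm_sub_rev]
  have h3 : ‖y - x‖ * (‖x‖⁻¹ * ‖y‖⁻¹) = ‖y - x‖ * ‖y‖⁻¹ * ‖x‖⁻¹ := by ring
  rw [h3]
  refine mul_le_mul_of_nonneg_right ?_ (inv_nonneg.2 hxp.le)
  rw [← div_eq_mul_inv, div_le_iff₀ hyp]
  nlinarith [mul_nonneg h0 hxp.le, mul_nonneg h0 hyp.le]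

end Fl

/-- Each summand passes through at most `s.card - 1` rounded additions, in whatever order they are
carried out; the induction follows the summation tree. -/
theorem FlSum.norm_sub_le {ι K : Type*} [NormedRing K] {ε : ℝ} (hε : 0 ≤ ε) {f : ι → K}
    {s : Finset ι} {c : K} (H : FlSum ε f s c) :
    0 < s.card ∧ ‖c - ∑ i ∈ s, f i‖ ≤ ((1 + ε) ^ (s.card - 1) - 1) * ∑ i ∈ s, ‖f i‖ := by
  induction H with
  | single i => simp
  | @add s t a b c hst hs ht hc ihs iht =>
    obtain ⟨hs0, ihs⟩ := ihs
    obtain ⟨ht0, iht⟩ := iht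
    refine ⟨by rw [Finset.card_disjUnion]; omega, ?_⟩
    rw [Finset.card_disjUnion, Finset.sum_disjUnion, Finset.sum_disjUnion]
    set S := ∑ i ∈ s, f i
    set T := ∑ i ∈ t, f i
    set S' := ∑ i ∈ s, ‖f i‖ with hS'
    set T' := ∑ i ∈ t, ‖f i‖ with hT'
    have hS0 : 0 ≤ S' := Finset.sum_nonneg fun _ _ => norm_nonneg _
    have hT0 : 0 ≤ T' := Finset.sum_nonneg fun _ _ => norm_nonneg _
    have hSS : ‖S‖ ≤ S' := norm_sum_le _ _
    have hTT : ‖T‖ ≤ T' := norm_sum_le _ _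
    -- Both subtrees are nonempty, so each has at most `m + 1` leaves and its exponent is at most
    -- `m`; the final addition supplies the remaining factor `1 + ε`.
    obtain ⟨m, hm⟩ : ∃ m, s.card + t.card = m + 2 := ⟨s.card + t.card - 2, by omega⟩
    have hsm : (1 + ε) ^ (s.card - 1) ≤ (1 + ε) ^ m :=
      pow_le_pow_right₀ (by linarith) (by omega)
    have htm : (1 + ε) ^ (t.card - 1) ≤ (1 + ε) ^ m :=
      pow_le_pow_right₀ (by linarith) (by omega)
    have e1 : ‖a - S‖ ≤ ((1 + ε) ^ m - 1) * S' :=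
      ihs.trans (mul_le_mul_of_nonneg_right (by linarith) hS0)
    have e2 : ‖b - T‖ ≤ ((1 + ε) ^ m - 1) * T' :=
      iht.trans (mul_le_mul_of_nonneg_right (by linarith) hT0)
    have e3 : ‖c - (a + b)‖ ≤ ε * ‖a + b‖ := hc
    have e4 : ‖(a + b) - (S + T)‖ ≤ ‖a - S‖ + ‖b - T‖ := by
      rw [add_sub_add_comm]; exact norm_add_le _ _
    have e5 : ‖a + b‖ ≤ ‖S + T‖ + ‖(a + b) - (S + T)‖ := by
      simpa using norm_add_le (S + T) ((a + b) - (S + T))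
    have e6 : ‖S + T‖ ≤ S' + T' := (norm_add_le _ _).trans (add_le_add hSS hTT)
    have e7 : ‖c - (S + T)‖ ≤ ‖c - (a + b)‖ + ‖(a + b) - (S + T)‖ := by
      simpa using norm_add_le (c - (a + b)) ((a + b) - (S + T))
    have e8 : ‖(a + b) - (S + T)‖ ≤ ((1 + ε) ^ m - 1) * (S' + T') := by linarith
    have e9 : ε * ‖a + b‖ ≤ ε * ((1 + ε) ^ m * (S' + T')) :=
      mul_le_mul_of_nonneg_left (by linarith) hε
    rw [hm, show m + 2 - 1 = m + 1 by omega, pow_succ]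
    calc _ ≤ _ := e7
      _ ≤ ε * ((1 + ε) ^ m * (S' + T')) + ((1 + ε) ^ m - 1) * (S' + T') :=
        add_le_add (e3.trans e9) e8
      _ = _ := by ring

theorem one_add_pow_sub_one_le {h : ℝ} (h0 : 0 ≤ h) {n : ℕ} (hn : n * h ≤ 1) :
    (1 + h) ^ n - 1 ≤ 2 * n * h := by
  have h1 : (1 + h) ^ n ≤ Real.exp (n * h) := by
    rw [Real.exp_nat_mul]
    exact pow_le_pow_left₀ (by linarith) (by linarith [Real.add_one_le_exp h]) _
  have hnn : 0 ≤ n * h := by positivity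
  have h2 := Real.abs_exp_sub_one_sub_id_le (x := n * h) (by rwa [abs_of_nonneg hnn])
  have h3 := (abs_le.1 h2).2
  nlinarith

/-- The rounding of the products adds one factor `1 + ε` to those of the summation, which gives the
exponent `s.card`. -/
theorem FlDot.norm_sub_le {ι K : Type*} [NormedField K] {ε : ℝ} (hε : 0 ≤ ε) {s : Finset ι}
    {a b : ι → K} {c : K} (H : FlDot ε s a b c) :
    ‖c - ∑ i ∈ s, a i * b i‖ ≤ ((1 + ε) ^ s.card - 1) * ∑ i ∈ s, ‖a i‖ * ‖b i‖ := by
  obtain ⟨p, hp, hs⟩ := H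
  obtain ⟨hpos, hb⟩ := hs.norm_sub_le hε
  have e1 : ‖∑ i ∈ s, p i - ∑ i ∈ s, a i * b i‖ ≤ ε * ∑ i ∈ s, ‖a i‖ * ‖b i‖ := by
    rw [← Finset.sum_sub_distrib, Finset.mul_sum]
    refine (norm_sum_le _ _).trans (Finset.sum_le_sum fun i hi => ?_)
    rw [← norm_mul]
    exact hp i hi
  have e2 : ∑ i ∈ s, ‖p i‖ ≤ (1 + ε) * ∑ i ∈ s, ‖a i‖ * ‖b i‖ := by
    rw [Finset.mul_sum]
    refine Finset.sum_le_sum fun i hi => ?_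
    rw [← norm_mul]
    exact (hp i hi).norm_le
  have e3 : ‖c - ∑ i ∈ s, a i * b i‖ ≤
      ‖c - ∑ i ∈ s, p i‖ + ‖∑ i ∈ s, p i - ∑ i ∈ s, a i * b i‖ := by
    simpa using norm_add_le (c - ∑ i ∈ s, p i) (∑ i ∈ s, p i - ∑ i ∈ s, a i * b i)
  obtain ⟨m, hm⟩ : ∃ m, s.card = m + 1 := ⟨s.card - 1, by omega⟩
  rw [hm] at hb ⊢
  rw [Nat.add_sub_cancel] at hb
  have h1 : 1 ≤ (1 + ε) ^ m := one_le_pow₀ (by linarith)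
  have e4 := mul_le_mul_of_nonneg_left e2 (show 0 ≤ (1 + ε) ^ m - 1 by linarith)
  rw [pow_succ]
  calc _ ≤ _ := e3
    _ ≤ ((1 + ε) ^ m - 1) * ((1 + ε) * ∑ i ∈ s, ‖a i‖ * ‖b i‖) + ε * ∑ i ∈ s, ‖a i‖ * ‖b i‖ :=
      add_le_add (hb.trans e4) e1
    _ = _ := by ring

/-- A computed Euclidean norm has a relative error of at most `3η`, if sums of `s.card` products have
relative errors of at most `η`. -/
theorem FlNorm.nonneg_and_fl {ι 𝕜 : Type*} [RCLike 𝕜] {ε η : ℝ} (hε : 0 ≤ ε) (hεη : ε ≤ η)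
    (hη : η ≤ 1 / 2) {s : Finset ι} {x : ι → 𝕜} {ν : ℝ}
    (hs : (1 + ε) ^ s.card - 1 ≤ η) (H : FlNorm ε s x ν) :
    0 ≤ ν ∧ Fl (3 * η) (Real.sqrt (∑ i ∈ s, ‖x i‖ ^ 2)) ν := by
  obtain ⟨q, t, hq, ht, hν⟩ := H
  have hdot : FlDot ε s (fun i => ‖x i‖) (fun i => ‖x i‖) t := ⟨q, by simpa only [sq] using hq, ht⟩
  have h1 := hdot.norm_sub_le hε
  simp only [norm_norm, ← sq] at h1
  set S := ∑ i ∈ s, ‖x i‖ ^ 2 with hS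
  have hS0 : 0 ≤ S := Finset.sum_nonneg fun _ _ => by positivity
  have h2 : |t - S| ≤ η * S := h1.trans (mul_le_mul_of_nonneg_right hs hS0)
  have ht0 : 0 ≤ t := by nlinarith [(abs_le.1 h2).1]
  have hr := Real.sqrt_nonneg S
  have hrt := Real.sqrt_nonneg t
  -- Square roots do not enlarge relative errors: divide `t - S = (√t - √S)(√t + √S)` by `√t + √S ≥
  -- √S`.
  have h3 : Fl η (Real.sqrt S) (Real.sqrt t) := by
    show |Real.sqrt t - Real.sqrt S| ≤ η * ‖Real.sqrt S‖
    rw [Real.norm_of_nonneg hr]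
    rcases hr.eq_or_lt with h0 | h0
    · have hS' : S = 0 := (Real.sqrt_eq_zero hS0).1 h0.symm
      have : t = 0 := by rw [hS'] at h2; simpa using h2
      rw [this, ← h0]; simp
    · have e : t - S = (Real.sqrt t - Real.sqrt S) * (Real.sqrt t + Real.sqrt S) := by
        nlinarith [Real.sq_sqrt hS0, Real.sq_sqrt ht0]
      rw [e, abs_mul, abs_of_nonneg (add_nonneg hrt hr)] at h2
      have e2 := mul_le_mul_of_nonneg_left (show Real.sqrt S ≤ Real.sqrt t + Real.sqrt S by linarith)
        (abs_nonneg (Real.sqrt t - Real.sqrt S))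
      refine le_of_mul_le_mul_right ?_ h0
      calc _ ≤ _ := e2
        _ ≤ _ := h2
        _ = η * Real.sqrt S * Real.sqrt S := by rw [mul_assoc, Real.mul_self_sqrt hS0]
  refine ⟨?_, (h3.trans hν hε).mono (by nlinarith)⟩
  have h4 : |ν - Real.sqrt t| ≤ ε * |Real.sqrt t| := hν
  rw [abs_of_nonneg hrt] at h4
  nlinarith [(abs_le.1 h4).1]

end FloatingPoint

/-! ### Euclidean norm of coordinate vectors -/

section EuclideanNorm

variable {𝕜 : Type*} [RCLike 𝕜] {n : ℕ}

/-- Euclidean norm of a coordinate vector. -/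
noncomputable def l2 (x : Fin n → 𝕜) : ℝ := ‖(WithLp.toLp 2 x : EuclideanSpace 𝕜 (Fin n))‖

theorem l2_eq (x : Fin n → 𝕜) : l2 x = Real.sqrt (∑ i, ‖x i‖ ^ 2) := by
  simp [l2, EuclideanSpace.norm_eq]

theorem l2_sq (x : Fin n → 𝕜) : l2 x ^ 2 = ∑ i, ‖x i‖ ^ 2 := by
  rw [l2_eq, Real.sq_sqrt (Finset.sum_nonneg fun _ _ => by positivity)]

theorem l2_nonneg (x : Fin n → 𝕜) : 0 ≤ l2 x := norm_nonneg _

theorem l2_add_le (x y : Fin n → 𝕜) : l2 (x + y) ≤ l2 x + l2 y := norm_add_le _ _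

theorem l2_sub_le (x y : Fin n → 𝕜) : l2 (x - y) ≤ l2 x + l2 y := norm_sub_le _ _

theorem l2_sub_comm (x y : Fin n → 𝕜) : l2 (x - y) = l2 (y - x) := norm_sub_rev _ _

theorem l2_sub_le_sub_add_sub (x y z : Fin n → 𝕜) : l2 (x - z) ≤ l2 (x - y) + l2 (y - z) :=
  norm_sub_le_norm_sub_add_norm_sub (WithLp.toLp 2 x) (WithLp.toLp 2 y) (WithLp.toLp 2 z)

theorem l2_smul (a : 𝕜) (x : Fin n → 𝕜) : l2 (a • x) = ‖a‖ * l2 x :=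
  norm_smul a (WithLp.toLp 2 x)

@[simp]
theorem l2_zero : l2 (0 : Fin n → 𝕜) = 0 := by simp [l2]

theorem l2_eq_zero {x : Fin n → 𝕜} : l2 x = 0 ↔ x = 0 := by
  rw [l2, norm_eq_zero, WithLp.toLp_eq_zero]

theorem norm_le_l2 (x : Fin n → 𝕜) (i : Fin n) : ‖x i‖ ≤ l2 x :=
  PiLp.norm_apply_le (WithLp.toLp 2 x) i

theorem l2_le_mul_of_norm_le {x y : Fin n → 𝕜} {h : ℝ} (h0 : 0 ≤ h)
    (H : ∀ i, ‖x i‖ ≤ h * ‖y i‖) : l2 x ≤ h * l2 y := by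
  refine le_of_sq_le_sq ?_ (mul_nonneg h0 (l2_nonneg y))
  rw [mul_pow, l2_sq, l2_sq, Finset.mul_sum]
  refine Finset.sum_le_sum fun i _ => ?_
  rw [← mul_pow]
  exact pow_le_pow_left₀ (norm_nonneg _) (H i) 2

theorem l2_le_card_mul {x : Fin n → 𝕜} {h : ℝ} (h0 : 0 ≤ h)
    (H : ∀ i, ‖x i‖ ≤ h) : l2 x ≤ n * h := by
  refine le_of_sq_le_sq ?_ (by positivity)
  rw [l2_sq]
  calc ∑ i, ‖x i‖ ^ 2 ≤ ∑ _i : Fin n, h ^ 2 :=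
        Finset.sum_le_sum fun i _ => pow_le_pow_left₀ (norm_nonneg _) (H i) 2
    _ = n * h ^ 2 := by simp
    _ ≤ (n * h) ^ 2 := by
      rw [mul_pow]
      refine mul_le_mul_of_nonneg_right ?_ (sq_nonneg h)
      exact_mod_cast Nat.le_self_pow (by norm_num) n

theorem sum_norm_mul_norm_le (s : Finset (Fin n)) (x y : Fin n → 𝕜) :
    ∑ i ∈ s, ‖x i‖ * ‖y i‖ ≤ l2 x * l2 y := by
  rw [l2_eq, l2_eq]
  refine le_trans ?_ (Real.sum_mul_le_sqrt_mul_sqrt Finset.univ (fun i => ‖x i‖) fun i => ‖y i‖)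
  exact Finset.sum_le_sum_of_subset_of_nonneg (Finset.subset_univ _) fun _ _ _ => by positivity

theorem norm_star_dotProduct_le (x y : Fin n → 𝕜) : ‖star x ⬝ᵥ y‖ ≤ l2 x * l2 y := by
  refine le_trans (norm_sum_le _ _) ?_
  simpa [norm_mul] using sum_norm_mul_norm_le Finset.univ x y

theorem star_dotProduct_self (x : Fin n → 𝕜) : star x ⬝ᵥ x = ((l2 x ^ 2 : ℝ) : 𝕜) := by
  rw [l2_sq, dotProduct]
  push_cast
  exact Finset.sum_congr rfl fun i _ => by
    rw [Pi.star_apply, RCLike.star_def, RCLike.conj_mul]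

theorem l2_mulVec_of_mem_unitaryGroup {U : Matrix (Fin n) (Fin n) 𝕜}
    (hU : U ∈ Matrix.unitaryGroup (Fin n) 𝕜) (x : Fin n → 𝕜) : l2 (U.mulVec x) = l2 x := by
  have h1 : star (U.mulVec x) ⬝ᵥ U.mulVec x = star x ⬝ᵥ x := by
    rw [Matrix.star_mulVec, Matrix.dotProduct_mulVec, Matrix.vecMul_vecMul,
      ← Matrix.dotProduct_mulVec, ← Matrix.star_eq_conjTranspose, (Matrix.mem_unitaryGroup_iff').1 hU,
      Matrix.one_mulVec]
  rw [star_dotProduct_self, star_dotProduct_self] at h1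
  have h2 : l2 (U.mulVec x) ^ 2 = l2 x ^ 2 := by exact_mod_cast h1
  exact (pow_left_inj₀ (l2_nonneg _) (l2_nonneg _) two_ne_zero).1 h2

end EuclideanNorm

/-! ### Exact Householder matrices and the error of one computed reflection -/

section Reflectors

open Matrix

variable {𝕜 : Type*} [RCLike 𝕜] {n : ℕ}

/-- The Householder matrix `I - γ u u^*`. -/
noncomputable def householder (u : Fin n → 𝕜) (γ : ℝ) : Matrix (Fin n) (Fin n) 𝕜 :=
  1 - (γ : 𝕜) • vecMulVec u (star u)

theorem householder_mulVec (u : Fin n → 𝕜) (γ : ℝ) (y : Fin n → 𝕜) :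
    (householder u γ).mulVec y = y - ((γ : 𝕜) * (star u ⬝ᵥ y)) • u := by
  rw [householder, sub_mulVec, one_mulVec, smul_mulVec, vecMulVec_mulVec, mul_smul,
    op_smul_eq_smul]

theorem conjTranspose_householder (u : Fin n → 𝕜) (γ : ℝ) :
    (householder u γ)ᴴ = householder u γ := by
  rw [householder, conjTranspose_sub, conjTranspose_smul, conjTranspose_vecMulVec]
  simp

theorem householder_mul_self {u : Fin n → 𝕜} {γ : ℝ} (h : γ * l2 u ^ 2 = 2 ∨ u = 0) :
    householder u γ * householder u γ = 1 := by
  rcases h with h | h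
  · have h' : (γ : 𝕜) * ((l2 u ^ 2 : ℝ) : 𝕜) = 2 := by
      exact_mod_cast congrArg (RCLike.ofReal (K := 𝕜)) h
    have e : vecMulVec u (star u) * vecMulVec u (star u)
        = ((l2 u ^ 2 : ℝ) : 𝕜) • vecMulVec u (star u) := by
      rw [vecMulVec_mul_vecMulVec, star_dotProduct_self, Matrix.vecMulVec_smul]
    rw [householder, sub_mul, mul_sub, mul_sub, smul_mul_smul_comm, e]
    simp only [one_mul, mul_one, smul_smul]
    rw [mul_assoc, h', mul_two, add_smul]
    abel
  · simp [householder, h]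

theorem householder_mem_unitaryGroup {u : Fin n → 𝕜} {γ : ℝ} (h : γ * l2 u ^ 2 = 2 ∨ u = 0) :
    householder u γ ∈ unitaryGroup (Fin n) 𝕜 := by
  rw [mem_unitaryGroup_iff, star_eq_conjTranspose, conjTranspose_householder,
    householder_mul_self h]

/-- The vector `x` with its entries above row `k` replaced by zeros. -/
def lowerPart (k : Fin n) (x : Fin n → 𝕜) : Fin n → 𝕜 := fun i => if i < k then 0 else x i

theorem l2_lowerPart_eq (k : Fin n) (x : Fin n → 𝕜) :
    l2 (lowerPart k x) = Real.sqrt (∑ i ∈ Finset.Ici k, ‖x i‖ ^ 2) := by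
  rw [l2_eq, ← Finset.sum_subset (Finset.subset_univ (Finset.Ici k))]
  · congr 1
    exact Finset.sum_congr rfl fun i hi => by
      rw [lowerPart, if_neg (not_lt.2 (Finset.mem_Ici.1 hi))]
  · intro i _ hi
    rw [lowerPart, if_pos (not_le.1 fun h => hi (Finset.mem_Ici.2 h))]
    simp

theorem l2_lowerPart_le (k : Fin n) (x : Fin n → 𝕜) : l2 (lowerPart k x) ≤ l2 x := by
  have := l2_le_mul_of_norm_le (x := lowerPart k x) (y := x) zero_le_one (fun i => by
    rw [one_mul, lowerPart]; split_ifs <;> simp)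
  simpa using this

/-- Inner products of length at most `n` with a perturbed vector. -/
theorem FlDot.norm_sub_star_dotProduct_le {ε η : ℝ} (hε : 0 ≤ ε) (hη : η ≤ 1 / 1000)
    (hn : (1 + ε) ^ n - 1 ≤ η) {k : Fin n} {u v y : Fin n → 𝕜} {w : 𝕜}
    (hv : ∀ i, i < k → v i = 0) (hvu : l2 (v - u) ≤ 13 * η * l2 u)
    (H : FlDot ε (Finset.Ici k) (fun i => star (v i)) y w) :
    ‖w - star u ⬝ᵥ y‖ ≤ 15 * η * (l2 u * l2 y) := by
  have hN0 := l2_nonneg u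
  have hY0 := l2_nonneg y
  have hη0 : 0 ≤ η := by
    have := one_le_pow₀ (n := n) (show (1 : ℝ) ≤ 1 + ε by linarith)
    linarith
  have hvN : l2 v ≤ (1 + 13 * η) * l2 u := by
    have := l2_add_le (v - u) u
    rw [sub_add_cancel] at this
    linarith
  have hsum : ∑ i ∈ Finset.Ici k, star (v i) * y i = star v ⬝ᵥ y := by
    refine Finset.sum_subset (Finset.subset_univ _) fun i _ hi => ?_
    rw [hv i (not_le.1 fun h => hi (Finset.mem_Ici.2 h))]
    simp
  have hcard : (1 + ε) ^ (Finset.Ici k).card - 1 ≤ η := by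
    have h1 : (Finset.Ici k).card ≤ n := by simp
    have := pow_le_pow_right₀ (show (1 : ℝ) ≤ 1 + ε by linarith) h1
    linarith
  have hw1 : ‖w - star v ⬝ᵥ y‖ ≤ η * (l2 v * l2 y) := by
    have h1 := H.norm_sub_le hε
    rw [hsum] at h1
    have h2 : ∑ i ∈ Finset.Ici k, ‖star (v i)‖ * ‖y i‖ ≤ l2 v * l2 y := by
      simpa only [norm_star] using sum_norm_mul_norm_le (Finset.Ici k) v y
    exact h1.trans (mul_le_mul hcard h2 (Finset.sum_nonneg fun _ _ => by positivity) hη0)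
  have hw2 : ‖star v ⬝ᵥ y - star u ⬝ᵥ y‖ ≤ 13 * η * l2 u * l2 y := by
    rw [← sub_dotProduct, ← star_sub]
    exact (norm_star_dotProduct_le _ _).trans (mul_le_mul_of_nonneg_right hvu hY0)
  have h1 := norm_sub_le_norm_sub_add_norm_sub w (star v ⬝ᵥ y) (star u ⬝ᵥ y)
  have h2 := mul_le_mul_of_nonneg_left (mul_le_mul_of_nonneg_right hvN hY0) hη0
  have h3 : η * ((1 + 13 * η) * l2 u * l2 y) ≤ 2 * η * (l2 u * l2 y) := by
    have h4 : η * (1 + 13 * η) ≤ 2 * η := by nlinarith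
    have := mul_le_mul_of_nonneg_right h4 (mul_nonneg hN0 hY0)
    linarith
  linarith

/-- The error of a computed reflection, relative to the exact reflection `I - γ u u^*`. -/
theorem FlReflect.l2_sub_le {ε η γ β : ℝ} (hε : 0 ≤ ε) (hεη : ε ≤ η) (hη : η ≤ 1 / 1000)
    (hn : (1 + ε) ^ n - 1 ≤ η) {k : Fin n} {u v y y' : Fin n → 𝕜}
    (hv : ∀ i, i < k → v i = 0) (hγ : 0 ≤ γ)
    (hγu : γ * l2 u ^ 2 ≤ 2) (hvu : l2 (v - u) ≤ 13 * η * l2 u) (hβ : Fl (22 * η) γ β)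
    (H : FlReflect ε k v β y y') :
    l2 (y' - (householder u γ).mulVec y) ≤ 170 * η * l2 y := by
  obtain ⟨hlt, w, g, hw, hg, hge⟩ := H
  have hη0 : 0 ≤ η := hε.trans hεη
  have hw3 := hw.norm_sub_star_dotProduct_le hε hη hn hv hvu
  have hvN : l2 v ≤ (1 + 13 * η) * l2 u := by
    have := l2_add_le (v - u) u
    rw [sub_add_cancel] at this
    linarith
  have hw₀N := norm_star_dotProduct_le u y
  rw [householder_mulVec]
  generalize star u ⬝ᵥ y = w₀ at hw3 hw₀N ⊢
  have hN0 := l2_nonneg u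
  have hY0 := l2_nonneg y
  have hM0 : 0 ≤ γ * (l2 u * l2 y) := mul_nonneg hγ (mul_nonneg hN0 hY0)
  -- The error `22 * η` of `β`, multiplied by `|w| ≤ 1.1 ‖u‖ ‖y‖`, and the error `15 * η` of `w`
  -- stay below `40 * η`; rounding the product adds at most `2 * η`, and the rest is slack.
  have hg2 : ‖g - (γ : 𝕜) * w₀‖ ≤ 62 * η * (γ * (l2 u * l2 y)) := by
    have hβw : ‖(β : 𝕜) * w - (γ : 𝕜) * w₀‖ ≤ 40 * η * (γ * (l2 u * l2 y)) := by
      have e : (β : 𝕜) * w - (γ : 𝕜) * w₀ = ((β - γ : ℝ) : 𝕜) * w + (γ : 𝕜) * (w - w₀) := by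
        push_cast; ring
      have hβ' : |β - γ| ≤ 22 * η * γ := by
        have : |β - γ| ≤ 22 * η * |γ| := hβ
        rwa [abs_of_nonneg hγ] at this
      have hwN : ‖w‖ ≤ 1.1 * (l2 u * l2 y) := by
        have h1 : ‖w‖ ≤ ‖w - w₀‖ + ‖w₀‖ := by simpa using norm_add_le (w - w₀) w₀
        have h2 := mul_le_mul_of_nonneg_right hη (mul_nonneg hN0 hY0)
        linarith [mul_nonneg hN0 hY0]
      rw [e]
      refine (norm_add_le _ _).trans ?_
      rw [norm_mul, norm_mul, RCLike.norm_ofReal, RCLike.norm_ofReal, abs_of_nonneg hγ]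
      have h1 := mul_le_mul hβ' hwN (norm_nonneg _) (by positivity)
      have h2 := mul_le_mul_of_nonneg_left hw3 hγ
      have h3 := mul_nonneg hη0 hM0
      linarith
    have hγw : ‖(γ : 𝕜) * w₀‖ ≤ γ * (l2 u * l2 y) := by
      rw [norm_mul, RCLike.norm_ofReal, abs_of_nonneg hγ]
      exact mul_le_mul_of_nonneg_left hw₀N hγ
    have h1 := norm_sub_le_norm_sub_add_norm_sub g ((β : 𝕜) * w) ((γ : 𝕜) * w₀)
    have h2 : ‖g - (β : 𝕜) * w‖ ≤ ε * ‖(β : 𝕜) * w‖ := hg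
    have h3 : ‖(β : 𝕜) * w‖ ≤ ‖(β : 𝕜) * w - (γ : 𝕜) * w₀‖ + ‖(γ : 𝕜) * w₀‖ := by
      simpa using norm_add_le ((β : 𝕜) * w - (γ : 𝕜) * w₀) ((γ : 𝕜) * w₀)
    have h6 := mul_le_mul_of_nonneg_right hη hM0
    have h4 : ‖(β : 𝕜) * w‖ ≤ 2 * (γ * (l2 u * l2 y)) := by linarith
    have h5 := mul_le_mul hεη h4 (norm_nonneg _) hη0
    linarith [mul_nonneg hη0 hM0]
  have hgN : ‖g‖ ≤ 1.1 * (γ * (l2 u * l2 y)) := by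
    have h1 : ‖g‖ ≤ ‖g - (γ : 𝕜) * w₀‖ + ‖(γ : 𝕜) * w₀‖ := by
      simpa using norm_add_le (g - (γ : 𝕜) * w₀) ((γ : 𝕜) * w₀)
    rw [norm_mul (γ : 𝕜), RCLike.norm_ofReal, abs_of_nonneg hγ] at h1
    have h2 := mul_le_mul_of_nonneg_left hw₀N hγ
    have h6 := mul_le_mul_of_nonneg_right hη hM0
    linarith
  -- The normalization `γ ‖u‖² ≤ 2` is what bounds all errors by `‖y‖` alone, independently of the
  -- scaling of `u`.
  have hgv : γ * (l2 u * l2 y) * l2 u ≤ 2 * l2 y := by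
    have := mul_le_mul_of_nonneg_right hγu hY0
    linarith
  have hgv0 : 0 ≤ γ * (l2 u * l2 y) * l2 u := mul_nonneg hM0 hN0
  generalize γ * (l2 u * l2 y) = M at *
  choose! p hp hp' using hge
  -- Extending the rounded products by zero above row `k` allows the untouched rows to be treated
  -- together with the others.
  let q : Fin n → 𝕜 := fun i => if i < k then 0 else p i
  have hq1 : l2 (q - g • v) ≤ ε * l2 (g • v) := by
    refine l2_le_mul_of_norm_le hε fun i => ?_
    by_cases hi : i < k
    · simp [q, hi, hv i hi]
    · simp only [q, hi, Pi.sub_apply, Pi.smul_apply, if_false, smul_eq_mul, mul_comm g]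
      exact hp i (not_lt.1 hi)
  have hgvN : l2 (g • v) ≤ 2.4 * l2 y := by
    rw [l2_smul]
    have h1 := mul_le_mul hgN hvN (l2_nonneg v) (by positivity)
    have h2 := mul_le_mul_of_nonneg_right hη hgv0
    linarith
  have hq2 : l2 (g • v - ((γ : 𝕜) * w₀) • u) ≤ 154 * η * l2 y := by
    have e : g • v - ((γ : 𝕜) * w₀) • u = g • (v - u) + (g - (γ : 𝕜) * w₀) • u := by
      rw [smul_sub, sub_smul]; abel
    rw [e]
    refine (l2_add_le _ _).trans ?_
    rw [l2_smul, l2_smul]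
    have h1 := mul_le_mul hgN hvu (l2_nonneg _) (by positivity)
    have h2 := mul_le_mul_of_nonneg_right hg2 hN0
    have h3 := mul_le_mul_of_nonneg_left hgv hη0
    have h4 := mul_nonneg hη0 hgv0
    linarith
  have hq3 := l2_sub_le_sub_add_sub q (g • v) (((γ : 𝕜) * w₀) • u)
  have hy1 : l2 (y' - (y - q)) ≤ ε * l2 (y - q) := by
    refine l2_le_mul_of_norm_le hε fun i => ?_
    by_cases hi : i < k
    · simp only [q, hi, Pi.sub_apply, if_true, sub_zero, hlt i hi, sub_self, norm_zero]
      positivity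
    · simp only [q, hi, Pi.sub_apply, if_false]
      exact hp' i (not_lt.1 hi)
  have h1 := mul_le_mul hεη hgvN (l2_nonneg _) hη0
  have hq : l2 q ≤ 3 * l2 y := by
    have h2 := l2_add_le (q - g • v) (g • v)
    rw [sub_add_cancel] at h2
    have h3 := mul_le_mul_of_nonneg_right hη hY0
    linarith
  have h2 : l2 (y' - (y - q)) ≤ η * (4 * l2 y) :=
    hy1.trans (mul_le_mul hεη (by linarith [_root_.l2_sub_le y q]) (l2_nonneg _) hη0)
  have h3 := l2_sub_le_sub_add_sub y' (y - q) (y - ((γ : 𝕜) * w₀) • u)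
  rw [sub_sub_sub_cancel_left, l2_sub_comm _ q] at h3
  have h4 := mul_nonneg hη0 hY0
  linarith

end Reflectors

/-! ### Accuracy of the computed Householder vectors -/

section ReflectorConstruction

open Matrix

variable {𝕜 : Type*} [RCLike 𝕜] {n : ℕ}

theorem Fl.ofReal {h a b : ℝ} (H : Fl h a b) : Fl h (a : 𝕜) (b : 𝕜) := by
  show ‖(b : 𝕜) - (a : 𝕜)‖ ≤ h * ‖(a : 𝕜)‖
  rw [← RCLike.ofReal_sub, RCLike.norm_ofReal, RCLike.norm_ofReal]
  exact H

theorem Fl.refl {K : Type*} [NormedField K] (x : K) : Fl 0 x x := by simp [Fl]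

theorem Fl.add_of_nonneg {h₁ h₂ a b a' b' : ℝ} (H₁ : Fl h₁ a a') (H₂ : Fl h₂ b b')
    (ha : 0 ≤ a) (hb : 0 ≤ b) (h : h₂ ≤ h₁) : Fl h₁ (a + b) (a' + b') := by
  have h1 : |a' - a| ≤ h₁ * |a| := H₁
  have h2 : |b' - b| ≤ h₂ * |b| := H₂
  show |a' + b' - (a + b)| ≤ h₁ * |a + b|
  rw [abs_of_nonneg ha] at h1
  rw [abs_of_nonneg hb] at h2
  rw [abs_of_nonneg (add_nonneg ha hb), add_sub_add_comm]
  have h3 := mul_le_mul_of_nonneg_right h hb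
  linarith [abs_add_le (a' - a) (b' - b)]

/-- The exact phase of the pivot entry; the value `1` at zero matches the convention in
`FlReflector`. -/
theorem exists_norm_eq_one_mul_eq (z : 𝕜) :
    ∃ φ : 𝕜, ‖φ‖ = 1 ∧ z = φ * (‖z‖ : 𝕜) ∧ (z ≠ 0 → φ = z * ((‖z‖ : ℝ) : 𝕜)⁻¹) ∧ (z = 0 → φ = 1) := by
  by_cases hz : z = 0
  · exact ⟨1, by simp, by simp [hz], fun h => absurd hz h, fun _ => rfl⟩
  · have hz' : ((‖z‖ : ℝ) : 𝕜) ≠ 0 := by simpa using hz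
    refine ⟨z * ((‖z‖ : ℝ) : 𝕜)⁻¹, ?_, ?_, fun _ => rfl, fun h => absurd h hz⟩
    · rw [norm_mul, norm_inv, RCLike.norm_ofReal, abs_norm, mul_inv_cancel₀ (norm_ne_zero_iff.2 hz)]
    · rw [mul_assoc, inv_mul_cancel₀ hz', mul_one]

/-- The computed pivot entry and the computed scaling factor of a reflector, for a vector whose
entries from row `k` on have the nonzero norm `ρ`. -/
theorem FlReflector.scalars {ε η ρ : ℝ} (hε : 0 ≤ ε) (hεη : ε ≤ η) (hη : η ≤ 1 / 1000)
    {k : Fin n} {x v : Fin n → 𝕜} {ν β : ℝ} {σ : 𝕜} (hρ : 0 ≤ ρ) (hν : Fl (3 * η) ρ ν)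
    (hν0 : ν ≠ 0) (H : FlReflector ε k x ν σ v β) :
    ∃ φ : 𝕜, ‖φ‖ = 1 ∧ x k = φ * (‖x k‖ : 𝕜) ∧ Fl (10 * η) (φ * (ρ : 𝕜)) σ ∧
      Fl (22 * η) ((ρ * (ρ + ‖x k‖))⁻¹) β := by
  obtain ⟨-, -, -, a, φ, d, b, ha, hφ0, hφ1, hσ, hd, hb, hβ⟩ := H.2 hν0
  have hη0 : 0 ≤ η := hε.trans hεη
  have hη2 : η * η ≤ η * (1 / 1000) := mul_le_mul_of_nonneg_left hη hη0
  have hηε : η * ε ≤ η * (1 / 1000) := mul_le_mul_of_nonneg_left (hεη.trans hη) hη0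
  have hε2 : ε * ε ≤ η * (1 / 1000) := mul_le_mul hεη (hεη.trans hη) hε hη0
  obtain ⟨φ₀, hφ₀, hφz, hφne, hφeq⟩ := exists_norm_eq_one_mul_eq (x k)
  refine ⟨φ₀, hφ₀, hφz, ?_, ?_⟩
  · have h1 : Fl (4 * η) φ₀ φ := by
      by_cases hz : x k = 0
      · rw [hφ0 hz, hφeq hz]
        exact (Fl.refl 1).mono (by linarith)
      · have h2 : Fl (2 * ε) (((‖x k‖ : ℝ) : 𝕜)⁻¹) ((a : 𝕜)⁻¹) :=
          (Fl.ofReal ha).inv hε (by linarith)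
        have h3 := (((Fl.refl (x k)).mul h2 le_rfl).mono
          (show 0 + 2 * ε + 0 * (2 * ε) ≤ 2 * ε by linarith)).trans
          (by simpa only [div_eq_mul_inv] using hφ1 hz) hε
        rw [hφne hz]
        exact h3.mono (by linarith)
    have h2 := (h1.mul (Fl.ofReal (𝕜 := 𝕜) hν) (by linarith)).trans hσ hε
    have h3 := mul_le_mul_of_nonneg_left hε2 hη0
    refine h2.mono ?_
    have h4 : 4 * η * (3 * η) ≤ η / 10 := by linarith
    have h5 : (4 * η + 3 * η + 4 * η * (3 * η)) * ε ≤ 8 * η * ε :=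
      mul_le_mul_of_nonneg_right (by linarith) hε
    linarith
  · have h1 : Fl (3 * η) (ρ + ‖x k‖) (ν + a) :=
      hν.add_of_nonneg ha hρ (norm_nonneg _) (by linarith)
    have h2 := (h1.trans hd hε).mono (show 3 * η + ε + 3 * η * ε ≤ 4.1 * η by linarith)
    have h3 := (hν.mul h2 (by linarith)).mono
      (show 3 * η + 4.1 * η + 3 * η * (4.1 * η) ≤ 7.2 * η by linarith)
    have h4 := (h3.trans hb hε).mono (show 7.2 * η + ε + 7.2 * η * ε ≤ 9 * η by linarith)
    have h5 := h4.inv (by linarith) (by linarith)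
    rw [← one_div b] at h5
    exact (h5.trans hβ hε).mono (by linarith)

/-- A computed reflector is close to an exact Householder reflector. -/
theorem FlReflector.exists_householder {ε η : ℝ} (hε : 0 ≤ ε) (hεη : ε ≤ η) (hη : η ≤ 1 / 1000)
    {k : Fin n} {x v : Fin n → 𝕜} {ν β : ℝ} {σ : 𝕜} (hν : Fl (3 * η) (l2 (lowerPart k x)) ν)
    (H : FlReflector ε k x ν σ v β) :
    ∃ (u : Fin n → 𝕜) (γ : ℝ), (∀ i, i < k → u i = 0) ∧ (∀ i, i < k → v i = 0) ∧ 0 ≤ γ ∧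
      (γ * l2 u ^ 2 = 2 ∨ u = 0) ∧ l2 (v - u) ≤ 13 * η * l2 u ∧ Fl (22 * η) γ β ∧
      l2 ((fun i => if i < k then x i else if i = k then -σ else 0)
        - (householder u γ).mulVec x) ≤ 10 * η * l2 x ∧
      (1 - 10 * η) * l2 (lowerPart k x) ≤ ‖σ‖ := by
  have hη0 : 0 ≤ η := hε.trans hεη
  set ρ := l2 (lowerPart k x) with hρ
  have hρ0 : 0 ≤ ρ := l2_nonneg _
  by_cases hν0 : ν = 0
  · obtain ⟨hσ, hv, hβ⟩ := H.1 hν0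
    -- A relative error below one cannot turn a nonzero norm into zero. The column thus vanishes
    -- from row `k` on, and the identity (`u = 0`) serves as the reflector.
    have hρ1 : ρ = 0 := by
      by_contra h
      exact hν.ne_zero (by linarith) h hν0
    have hx : lowerPart k x = 0 := l2_eq_zero.1 hρ1
    refine ⟨0, 0, fun _ _ => rfl, fun i _ => by rw [hv]; rfl, le_rfl, Or.inr rfl, by simp [hv],
      by simp [hβ, Fl], ?_, by simp [hρ1]⟩
    have : (fun i => if i < k then x i else if i = k then -σ else 0) = x := by
      funext i
      have hi := congrFun hx i
      simp only [lowerPart, Pi.zero_apply] at hi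
      split_ifs with h1 h2
      · rfl
      · rw [if_neg h1] at hi; rw [hi, hσ, neg_zero]
      · rw [if_neg h1] at hi; rw [hi]
    rw [this]
    simp only [householder_mulVec, smul_zero, sub_zero, sub_self, l2_zero]
    exact mul_nonneg (by linarith) (l2_nonneg x)
  · have hρ1 : ρ ≠ 0 := fun h => hν0 (hν.eq_zero h)
    have hρp : 0 < ρ := lt_of_le_of_ne hρ0 hρ1.symm
    obtain ⟨φ, hφ, hxφ, hσ, hβ⟩ := H.scalars hε hεη hη hρ0 hν hν0
    obtain ⟨hv0, hvx, hvk, -⟩ := H.2 hν0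
    set μ := ‖x k‖ with hμ
    have hμ0 : 0 ≤ μ := norm_nonneg _
    have hφφ : star φ * φ = 1 := by
      rw [RCLike.star_def, RCLike.conj_mul, hφ]; simp
    have hreal : ∀ t : ℝ, star (t : 𝕜) = t := fun t => by rw [RCLike.star_def, RCLike.conj_ofReal]
    -- The exact Householder vector. Adding `φ ρ` with the phase of `x k` avoids cancellation.
    set u : Fin n → 𝕜 := lowerPart k x + Pi.single k (φ * (ρ : 𝕜)) with hu
    set γ : ℝ := (ρ * (ρ + μ))⁻¹ with hγ
    have hpos : 0 < ρ * (ρ + μ) := by positivity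
    have hγ0 : 0 ≤ γ := inv_nonneg.2 hpos.le
    have hult : ∀ i, i < k → u i = 0 := fun i hi => by
      simp [hu, lowerPart, hi, hi.ne]
    have huk : u k = x k + φ * (ρ : 𝕜) := by simp [hu, lowerPart]
    have hugt : ∀ i, k < i → u i = x i := fun i hi => by
      simp [hu, lowerPart, hi.ne', not_lt.2 hi.le]
    have hux : star u ⬝ᵥ x = ((ρ * (ρ + μ) : ℝ) : 𝕜) := by
      have h1 : star (lowerPart k x) ⬝ᵥ x = star (lowerPart k x) ⬝ᵥ lowerPart k x := by
        refine Finset.sum_congr rfl fun i _ => ?_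
        by_cases hi : i < k <;> simp [lowerPart, hi]
      have h2 : star (Pi.single k (φ * (ρ : 𝕜)) : Fin n → 𝕜) ⬝ᵥ x = ((ρ * μ : ℝ) : 𝕜) := by
        rw [← Pi.single_star, single_dotProduct, hxφ, star_mul, hreal]
        push_cast
        linear_combination (ρ * μ : 𝕜) * hφφ
      rw [hu, star_add, add_dotProduct, h1, h2, star_dotProduct_self, ← hρ, ← RCLike.ofReal_add]
      congr 1; ring
    have huu : l2 u ^ 2 = 2 * (ρ * (ρ + μ)) := by
      have h1 : star u ⬝ᵥ u = ((2 * (ρ * (ρ + μ)) : ℝ) : 𝕜) := by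
        have h2 : star u ⬝ᵥ u = star u ⬝ᵥ x + star (u k) * (φ * (ρ : 𝕜)) := by
          have h3 : star u ⬝ᵥ x = star u ⬝ᵥ lowerPart k x := by
            refine Finset.sum_congr rfl fun i _ => ?_
            by_cases hi : i < k
            · simp [hult i hi]
            · simp [lowerPart, hi]
          rw [h3]
          conv_lhs => rw [hu]
          rw [dotProduct_add, dotProduct_single, ← hu, Pi.star_apply]
        rw [h2, hux, huk, hxφ, star_add, star_mul, star_mul, hreal, hreal]
        push_cast
        linear_combination (ρ * (ρ + μ) : 𝕜) * hφφ
      rw [star_dotProduct_self] at h1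
      exact_mod_cast h1
    have hγu : (γ : 𝕜) * (star u ⬝ᵥ x) = 1 := by
      rw [hux, ← RCLike.ofReal_mul, hγ, inv_mul_cancel₀ hpos.ne', RCLike.ofReal_one]
    -- This lets the error of `σ`, which is relative to `ρ`, count as an error relative to `‖u‖`.
    have hρu : ρ ≤ l2 u := by
      refine le_of_sq_le_sq ?_ (l2_nonneg u)
      rw [huu]; nlinarith [mul_nonneg hρ0 hμ0]
    have hσ' : ‖σ - φ * (ρ : 𝕜)‖ ≤ 10 * η * ρ := by
      have : ‖σ - φ * (ρ : 𝕜)‖ ≤ 10 * η * ‖φ * (ρ : 𝕜)‖ := hσ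
      rwa [norm_mul, hφ, one_mul, RCLike.norm_ofReal, abs_of_nonneg hρ0] at this
    have hsingle : ∀ z : 𝕜, l2 (Pi.single k z : Fin n → 𝕜) = ‖z‖ := fun z => by
      rw [l2_eq, Finset.sum_eq_single k]
      · simp
      · intro i _ hi; simp [hi]
      · simp
    refine ⟨u, γ, hult, hv0, hγ0, Or.inl ?_, ?_, hβ, ?_, ?_⟩
    · rw [huu, hγ]; field_simp
    · have h1 : v - u = Pi.single k (v k - u k) := by
        funext i
        rcases lt_trichotomy i k with hi | rfl | hi
        · simp [hv0 i hi, hult i hi, hi.ne]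
        · simp
        · simp [hvx i hi, hugt i hi, hi.ne']
      rw [h1, hsingle, huk]
      have h2 : ‖v k - (x k + σ)‖ ≤ ε * ‖x k + σ‖ := hvk
      have h3 : ‖v k - (x k + φ * (ρ : 𝕜))‖ ≤ ‖v k - (x k + σ)‖ + ‖σ - φ * (ρ : 𝕜)‖ := by
        have := norm_add_le (v k - (x k + σ)) (σ - φ * (ρ : 𝕜))
        refine le_trans (le_of_eq ?_) this
        congr 1; ring
      have h4 : ‖x k + σ‖ ≤ ‖u k‖ + ‖σ - φ * (ρ : 𝕜)‖ := by
        have := norm_add_le (u k) (σ - φ * (ρ : 𝕜))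
        refine le_trans (le_of_eq ?_) this
        congr 1; rw [huk]; ring
      have h5 := norm_le_l2 u k
      have h6 := mul_le_mul_of_nonneg_left hρu (show 0 ≤ 10 * η by linarith)
      have h7 := mul_le_mul_of_nonneg_right hη (l2_nonneg u)
      have h8 := mul_le_mul hεη (show ‖x k + σ‖ ≤ 1.1 * l2 u by linarith [l2_nonneg u])
        (norm_nonneg _) hη0
      linarith [mul_nonneg hη0 (l2_nonneg u)]
    -- Since `γ u^* x = 1`, the exact reflection of `x` is `x - u`; the prescribed zeros are exact
    -- and only the pivot entry `-σ` differs.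
    · have h1 : (fun i => if i < k then x i else if i = k then -σ else 0)
          - (householder u γ).mulVec x = Pi.single k (φ * (ρ : 𝕜) - σ) := by
        rw [householder_mulVec, hγu, one_smul]
        funext i
        rcases lt_trichotomy i k with hi | rfl | hi
        · simp [hi, hult i hi, hi.ne]
        · simp only [Pi.sub_apply, lt_irrefl, if_false, if_true, huk, Pi.single_eq_same]; ring
        · simp [not_lt.2 hi.le, hugt i hi, hi.ne']
      rw [h1, hsingle, norm_sub_rev]
      exact hσ'.trans (mul_le_mul_of_nonneg_left (l2_lowerPart_le k x) (by linarith))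
    · have := hσ.le_norm
      rwa [norm_mul, hφ, one_mul, RCLike.norm_ofReal, abs_of_nonneg hρ0] at this

end ReflectorConstruction

/-! ### Accumulation of errors over a sequence of reflections -/

section Accumulation

open Matrix

variable {𝕜 : Type*} [RCLike 𝕜] {n : ℕ}

theorem l2_sub_le_of_step {h : ℝ} (h0 : 0 ≤ h) (u : ℕ → Fin n → 𝕜)
    (hu : ∀ k, k < n → l2 (u (k + 1) - u k) ≤ h * l2 (u k)) :
    ∀ k, k ≤ n → l2 (u k - u 0) ≤ ((1 + h) ^ k - 1) * l2 (u 0) := by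
  intro k
  induction k with
  | zero => intro _; simp
  | succ k ih =>
    intro hk
    have h1 := ih (by omega)
    have h2 := hu k (by omega)
    have h3 := l2_sub_le_sub_add_sub (u (k + 1)) (u k) (u 0)
    have h4 := l2_add_le (u k - u 0) (u 0)
    rw [sub_add_cancel] at h4
    have h5 := mul_le_mul_of_nonneg_left (h4.trans (add_le_add_left h1 _)) h0
    rw [pow_succ]
    linarith

theorem exists_partial_products {H : Fin n → Matrix (Fin n) (Fin n) 𝕜}
    (hH : ∀ k, H k ∈ unitaryGroup (Fin n) 𝕜) :
    ∃ P : ℕ → Matrix (Fin n) (Fin n) 𝕜, P 0 = 1 ∧ (∀ k : Fin n, P (k + 1) = P k * H k) ∧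
      ∀ k, P k ∈ unitaryGroup (Fin n) 𝕜 := by
  -- Beyond index `n` the sequence stays constant, which makes unitarity hold for every natural
  -- index.
  let P : ℕ → Matrix (Fin n) (Fin n) 𝕜 := fun k =>
    Nat.rec 1 (fun k M => if h : k < n then M * H ⟨k, h⟩ else M) k
  have hP : ∀ k : ℕ, P (k + 1) = if h : k < n then P k * H ⟨k, h⟩ else P k := fun _ => rfl
  refine ⟨P, rfl, fun k => by rw [hP, dif_pos k.2], fun k => ?_⟩
  induction k with
  | zero => exact one_mem _
  | succ k ih =>
    rw [hP]
    split_ifs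
    · exact mul_mem ih (hH _)
    · exact ih

/-- Since `H k` is an involution, `P k z_k = P (k + 1) (H k z_k)`. The pulled-back iterates `P k
z_k` therefore change in each step only by an isometric image of the local error. -/
theorem l2_mulVec_sub_le_of_forward {H : Fin n → Matrix (Fin n) (Fin n) 𝕜}
    (hHH : ∀ k, H k * H k = 1) {P : ℕ → Matrix (Fin n) (Fin n) 𝕜} (hP0 : P 0 = 1)
    (hP : ∀ k : Fin n, P (k + 1) = P k * H k) (hPu : ∀ k, P k ∈ unitaryGroup (Fin n) 𝕜)
    {h : ℝ} (h0 : 0 ≤ h) (z : ℕ → Fin n → 𝕜)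
    (hz : ∀ k : Fin n, l2 (z (k + 1) - (H k).mulVec (z k)) ≤ h * l2 (z k)) :
    l2 ((P n).mulVec (z n) - z 0) ≤ ((1 + h) ^ n - 1) * l2 (z 0) := by
  have h1 := l2_sub_le_of_step h0 (fun k => (P k).mulVec (z k)) (fun k hk => ?_) n le_rfl
  · simpa only [hP0, one_mulVec] using h1
  · have h2 : (P k).mulVec (z k) = (P (k + 1)).mulVec ((H ⟨k, hk⟩).mulVec (z k)) := by
      rw [hP ⟨k, hk⟩, mulVec_mulVec, mul_assoc, hHH, mul_one]
    rw [h2, ← mulVec_sub, l2_mulVec_of_mem_unitaryGroup (hPu _), ← h2,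
      l2_mulVec_of_mem_unitaryGroup (hPu _)]
    exact hz ⟨k, hk⟩

/-- The same pullback with the index reversed, as needed for the backward accumulation of `Q`. -/
theorem l2_sub_mulVec_le_of_backward {H : Fin n → Matrix (Fin n) (Fin n) 𝕜}
    {P : ℕ → Matrix (Fin n) (Fin n) 𝕜} (hP0 : P 0 = 1)
    (hP : ∀ k : Fin n, P (k + 1) = P k * H k) (hPu : ∀ k, P k ∈ unitaryGroup (Fin n) 𝕜)
    {h : ℝ} (h0 : 0 ≤ h) (z : ℕ → Fin n → 𝕜)
    (hz : ∀ k : Fin n, l2 (z k - (H k).mulVec (z (k + 1))) ≤ h * l2 (z (k + 1))) :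
    l2 (z 0 - (P n).mulVec (z n)) ≤ ((1 + h) ^ n - 1) * l2 (z n) := by
  have h1 := l2_sub_le_of_step h0 (fun m => (P (n - m)).mulVec (z (n - m))) (fun m hm => ?_)
    n le_rfl
  · simpa only [hP0, one_mulVec, Nat.sub_self, Nat.sub_zero,
      l2_mulVec_of_mem_unitaryGroup (hPu _)] using h1
  · obtain ⟨k, hk⟩ : ∃ k, n - m = k + 1 := ⟨n - m - 1, by omega⟩
    have hk' : n - (m + 1) = k := by omega
    simp only [hk, hk']
    have h2 : (P (k + 1)).mulVec (z (k + 1))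
        = (P k).mulVec ((H ⟨k, by omega⟩).mulVec (z (k + 1))) := by
      rw [hP ⟨k, by omega⟩, mulVec_mulVec]
    rw [h2, ← mulVec_sub, l2_mulVec_of_mem_unitaryGroup (hPu _), ← h2,
      l2_mulVec_of_mem_unitaryGroup (hPu _)]
    exact hz ⟨k, by omega⟩

end Accumulation

/-! ### One step of the factorization -/

section PivotedQR

open Matrix

variable {𝕜 : Type*} [RCLike 𝕜] {n : ℕ}

/-- A reflection in step `k` reads and changes only rows from `k` on, so erasing rows above `m ≤ k`
leaves it admissible. This localizes the norm estimates to the rows that matter for dominance. -/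
theorem FlReflect.lowerPart {ε β : ℝ} {m k : Fin n} (h : m ≤ k) {v y y' : Fin n → 𝕜}
    (H : FlReflect ε k v β y y') : FlReflect ε k v β (lowerPart m y) (lowerPart m y') := by
  have hy : ∀ (x : Fin n → 𝕜) i, k ≤ i → _root_.lowerPart m x i = x i := fun x i hi => by
    simp [_root_.lowerPart, not_lt.2 (h.trans hi)]
  obtain ⟨hlt, w, g, ⟨p, hp, hs⟩, hg, hge⟩ := H
  refine ⟨fun i hi => by simp only [_root_.lowerPart, hlt i hi], w, g,
    ⟨p, fun i hi => by rw [hy y i (Finset.mem_Ici.1 hi)]; exact hp i hi, hs⟩, hg, fun i hi => ?_⟩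
  rw [hy y i hi, hy y' i hi]
  exact hge i hi

theorem FlReflector.lowerPart {ε ν β : ℝ} {m k : Fin n} (h : m ≤ k) {x v : Fin n → 𝕜} {σ : 𝕜}
    (H : FlReflector ε k x ν σ v β) : FlReflector ε k (lowerPart m x) ν σ v β := by
  have hy : ∀ i, k ≤ i → _root_.lowerPart m x i = x i := fun i hi => by
    simp [_root_.lowerPart, not_lt.2 (h.trans hi)]
  refine ⟨H.1, fun hν => ?_⟩
  obtain ⟨h1, h2, h3⟩ := H.2 hν
  rw [hy k le_rfl]
  exact ⟨h1, fun i hi => by rw [hy i hi.le]; exact h2 i hi, h3⟩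

/-- An exact reflection that is close to the computed one. -/
theorem exists_exact_reflection {ε η : ℝ} (hε : 0 ≤ ε) (hεη : ε ≤ η) (hη : η ≤ 1 / 1000)
    (hn : (1 + ε) ^ n - 1 ≤ η) {k : Fin n} {x v : Fin n → 𝕜} {ν β : ℝ} {σ : 𝕜}
    (hν : FlNorm ε (Finset.Ici k) x ν) (H : FlReflector ε k x ν σ v β) :
    ∃ M : Matrix (Fin n) (Fin n) 𝕜, M ∈ unitaryGroup (Fin n) 𝕜 ∧ M * M = 1 ∧
      (∀ y, lowerPart k y = 0 → M.mulVec y = y) ∧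
      (∀ y y', FlReflect ε k v β y y' → l2 (y' - M.mulVec y) ≤ 170 * η * l2 y) ∧
      l2 ((fun i => if i < k then x i else if i = k then -σ else 0) - M.mulVec x)
        ≤ 170 * η * l2 x ∧
      (1 - 10 * η) * l2 (lowerPart k x) ≤ ‖σ‖ := by
  have hη0 : 0 ≤ η := hε.trans hεη
  have hcard : (1 + ε) ^ (Finset.Ici k).card - 1 ≤ η := by
    have h1 : (Finset.Ici k).card ≤ n := by simp
    have := pow_le_pow_right₀ (show (1 : ℝ) ≤ 1 + ε by linarith) h1
    linarith
  have hν' := (hν.nonneg_and_fl hε hεη (by linarith) hcard).2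
  rw [← l2_lowerPart_eq] at hν'
  obtain ⟨u, γ, hu, hv, hγ, hγu, hvu, hβ, hx, hσ⟩ := H.exists_householder hε hεη hη hν'
  refine ⟨householder u γ, householder_mem_unitaryGroup hγu, householder_mul_self hγu, ?_, ?_,
    hx.trans (mul_le_mul_of_nonneg_right (by linarith) (l2_nonneg x)), hσ⟩
  · intro y hy
    have : star u ⬝ᵥ y = 0 := by
      refine Finset.sum_eq_zero fun i _ => ?_
      by_cases hi : i < k
      · simp [hu i hi]
      · have := congrFun hy i
        rw [lowerPart, if_neg hi] at this
        simp [this]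
    rw [householder_mulVec, this]
    simp
  · intro y y' hyy
    refine hyy.l2_sub_le hε hεη hη hn hv hγ ?_ hvu hβ
    rcases hγu with h | h
    · exact h.le
    · simp [h]

/-- Growth of the norm of a vector in one computed reflection. -/
theorem l2_le_of_l2_sub_mulVec_le {M : Matrix (Fin n) (Fin n) 𝕜}
    (hM : M ∈ unitaryGroup (Fin n) 𝕜) {h : ℝ} {y y' : Fin n → 𝕜}
    (H : l2 (y' - M.mulVec y) ≤ h * l2 y) : l2 y' ≤ (1 + h) * l2 y := by
  have h1 := l2_add_le (y' - M.mulVec y) (M.mulVec y)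
  rw [sub_add_cancel, l2_mulVec_of_mem_unitaryGroup hM] at h1
  linarith

end PivotedQR

/-! ### Backward error analysis of the pivoted factorization -/

section ErrorAnalysis

open Matrix

theorem column_eq_of_frozen {K : Type*} {n : ℕ} {W : ℕ → Matrix (Fin n) (Fin n) K}
    (hW : ∀ k : Fin n, ∀ j, j < k → ∀ i, W (k + 1) i j = W k i j) (j : Fin n) {k : ℕ}
    (hjk : (j : ℕ) + 1 ≤ k) (hk : k ≤ n) (i : Fin n) : W k i j = W (j + 1) i j := by
  induction k, hjk using Nat.le_induction with
  | base => rfl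
  | succ k hjk ih =>
    rw [hW ⟨k, by omega⟩ j (Fin.lt_def.2 (by simpa using hjk)) i]
    exact ih (by omega)

variable {𝕜 : Type*} [RCLike 𝕜] {n : ℕ}

/-- One step of the computed factorization, as the approximate application of an exact
reflection to all columns of the working array. -/
theorem exists_reflection_of_step {ε η : ℝ} (hε : 0 ≤ ε) (hεη : ε ≤ η) (hη : η ≤ 1 / 1000)
    (hn : (1 + ε) ^ n - 1 ≤ η) {k : Fin n} {W W' : Matrix (Fin n) (Fin n) 𝕜} {v : Fin n → 𝕜}
    {ν β : ℝ} {σ : 𝕜} (hzero : ∀ j, j < k → ∀ i, j < i → W i j = 0)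
    (hν : FlNorm ε (Finset.Ici k) (fun i => W i k) ν)
    (H : FlReflector ε k (fun i => W i k) ν σ v β)
    (h₁ : ∀ j, j < k → ∀ i, W' i j = W i j)
    (h₂ : ∀ i, W' i k = if i < k then W i k else if i = k then -σ else 0)
    (h₃ : ∀ j, k < j → FlReflect ε k v β (fun i => W i j) (fun i => W' i j)) :
    ∃ M : Matrix (Fin n) (Fin n) 𝕜, M ∈ unitaryGroup (Fin n) 𝕜 ∧ M * M = 1 ∧
      (∀ y y', FlReflect ε k v β y y' → l2 (y' - M.mulVec y) ≤ 170 * η * l2 y) ∧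
      ∀ j, l2 ((fun i => W' i j) - M.mulVec fun i => W i j) ≤ 170 * η * l2 fun i => W i j := by
  have hη0 : 0 ≤ η := hε.trans hεη
  obtain ⟨M, hM, hMM, hfix, hrefl, hcol, -⟩ := exists_exact_reflection hε hεη hη hn hν H
  refine ⟨M, hM, hMM, hrefl, fun j => ?_⟩
  rcases lt_trichotomy j k with hj | rfl | hj
  -- A finished column already vanishes from row `k` on, hence the exact reflection fixes it and no
  -- error arises.
  · have h4 : (fun i => W' i j) = fun i => W i j := funext (h₁ j hj)
    rw [h4, hfix, sub_self, l2_zero]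
    · exact mul_nonneg (by linarith) (l2_nonneg _)
    · funext i
      by_cases hi : i < k
      · simp [lowerPart, hi]
      · simp [lowerPart, hi, hzero j hj i (hj.trans_le (not_lt.1 hi))]
  · rw [show (fun i => W' i j) = _ from funext h₂]
    exact hcol
  · exact hrefl _ _ (h₃ j hj)

/-- In one step of the computed factorization, the rows from `m ≤ k` on of a column grow at most by
rounding errors. -/
theorem l2_lowerPart_le_of_step {ε η : ℝ} (hε : 0 ≤ ε) (hεη : ε ≤ η) (hη : η ≤ 1 / 1000)
    (hn : (1 + ε) ^ n - 1 ≤ η) {m k : Fin n} (hmk : m ≤ k) {W W' : Matrix (Fin n) (Fin n) 𝕜}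
    {v : Fin n → 𝕜} {ν β : ℝ} {σ : 𝕜}
    (hν : FlNorm ε (Finset.Ici k) (fun i => W i k) ν)
    (H : FlReflector ε k (fun i => W i k) ν σ v β)
    (h₁ : ∀ j, j < k → ∀ i, W' i j = W i j)
    (h₂ : ∀ i, W' i k = if i < k then W i k else if i = k then -σ else 0)
    (h₃ : ∀ j, k < j → FlReflect ε k v β (fun i => W i j) (fun i => W' i j)) (j : Fin n) :
    l2 (lowerPart m fun i => W' i j) ≤ (1 + 170 * η) * l2 (lowerPart m fun i => W i j) := by
  have hη0 : 0 ≤ η := hε.trans hεη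
  rcases lt_trichotomy j k with hj | rfl | hj
  · rw [show (fun i => W' i j) = fun i => W i j from funext (h₁ j hj)]
    have := mul_nonneg hη0 (l2_nonneg (lowerPart m fun i => W i j))
    linarith
  · have hν' : FlNorm ε (Finset.Ici j) (lowerPart m fun i => W i j) ν := by
      obtain ⟨q, t, hq, ht⟩ := hν
      refine ⟨q, t, fun i hi => ?_, ht⟩
      rw [lowerPart, if_neg (not_lt.2 (hmk.trans (Finset.mem_Ici.1 hi)))]
      exact hq i hi
    obtain ⟨M, hM, -, -, -, hcol, -⟩ :=
      exists_exact_reflection hε hεη hη hn hν' (H.lowerPart hmk)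
    refine l2_le_of_l2_sub_mulVec_le hM (le_of_eq_of_le ?_ hcol)
    congr 2
    funext i
    by_cases hi : i < m
    · simp [lowerPart, hi, hi.trans_le hmk]
    · simp [lowerPart, hi, h₂]
  · obtain ⟨M, hM, -, -, hrefl, -⟩ := exists_exact_reflection hε hεη hη hn hν H
    exact l2_le_of_l2_sub_mulVec_le hM (hrefl _ _ ((h₃ j hj).lowerPart hmk))

theorem l2_le_pow_mul_of_step {h : ℝ} (h0 : 0 ≤ h) {m : ℕ} {z : ℕ → ℝ} {k : ℕ} (hmk : m ≤ k)
    (hz : ∀ i, m ≤ i → i < k → z (i + 1) ≤ (1 + h) * z i) : z k ≤ (1 + h) ^ (k - m) * z m := by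
  induction k, hmk using Nat.le_induction with
  | base => simp
  | succ k hk ih =>
    have h1 := ih fun i hi hik => hz i hi (hik.trans (Nat.lt_succ_self k))
    have h2 := hz k hk (Nat.lt_succ_self k)
    rw [Nat.succ_sub hk, pow_succ']
    have := mul_le_mul_of_nonneg_left h1 (show 0 ≤ 1 + h by linarith)
    linarith

/-- Backward error analysis of the Householder QR factorization with column pivoting, of the
explicitly formed unitary factor, and of products with it. -/
theorem IsPivotedQR.exists_unitary {ε : ℝ} (hε : 0 ≤ ε)
    (hc : 10000 * (n : ℝ) ^ 3 * ε ≤ 1) {E R : Matrix (Fin n) (Fin n) 𝕜} {π : Equiv.Perm (Fin n)}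
    {v : Fin n → Fin n → 𝕜} {β : Fin n → ℝ} (H : IsPivotedQR ε E π v β R) :
    ∃ P ∈ unitaryGroup (Fin n) 𝕜,
      (∀ i j, j < i → R i j = 0) ∧
      (∀ j, l2 ((P.mulVec fun i => R i j) - fun i => E i (π j))
        ≤ 680 * (n : ℝ) ^ 2 * ε * l2 fun i => E i (π j)) ∧
      (∀ Q, IsFormedQ ε v β Q → ∀ j, l2 (fun i => Q i j - P i j) ≤ 680 * (n : ℝ) ^ 2 * ε) ∧
      (∀ D X, IsReflectorProduct ε v β D X → ∀ j,
        l2 ((P.mulVec fun i => X i j) - fun i => D i j)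
          ≤ 680 * (n : ℝ) ^ 2 * ε * l2 fun i => D i j) ∧
      ∀ i j, i ≤ j →
        l2 (lowerPart i fun l => R l j) ≤ (1 + 800 * ((n : ℝ) ^ 3 * ε)) * ‖R i i‖ := by
  rcases eq_or_ne n 0 with rfl | hn0
  · exact ⟨1, one_mem _, fun i => i.elim0, fun i => i.elim0, fun _ _ i => i.elim0,
      fun _ _ _ i => i.elim0, fun i => i.elim0⟩
  have hn1 : (1 : ℝ) ≤ n := by exact_mod_cast Nat.one_le_iff_ne_zero.2 hn0
  have hnε : (n : ℝ) * ε ≤ (n : ℝ) ^ 3 * ε :=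
    mul_le_mul_of_nonneg_right (by simpa using pow_le_pow_right₀ hn1 (show 1 ≤ 3 by norm_num)) hε
  have hn2ε : (n : ℝ) ^ 2 * ε ≤ (n : ℝ) ^ 3 * ε :=
    mul_le_mul_of_nonneg_right (pow_le_pow_right₀ hn1 (by norm_num)) hε
  have hεn : ε ≤ n * ε := le_mul_of_one_le_left hε hn1
  -- `η` bounds the relative error of inner products of length at most `n`; then `n` reflections
  -- cost at most `2 * n * (170 * η) = 680 * n ^ 2 * ε`.
  obtain ⟨η, hη⟩ : ∃ η, η = 2 * n * ε := ⟨_, rfl⟩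
  have hη0 : 0 ≤ η := by rw [hη]; positivity
  have hεη : ε ≤ η := by linarith
  have hη1 : η ≤ 1 / 1000 := by linarith
  have hpow : (1 + ε) ^ n - 1 ≤ η := by
    rw [hη]; exact one_add_pow_sub_one_le hε (by linarith)
  have hh0 : 0 ≤ 170 * η := by linarith
  have hpow2 : (1 + 170 * η) ^ n - 1 ≤ 680 * (n : ℝ) ^ 2 * ε := by
    have := one_add_pow_sub_one_le hh0 (n := n) (by rw [hη]; nlinarith)
    refine this.trans (le_of_eq ?_)
    rw [hη]; ring
  obtain ⟨W, ν, σ, hW0, hWn, hstep⟩ := H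
  have hfrozen := column_eq_of_frozen fun k j hj i => (hstep k).2.2.2.1 j hj i
  have hzero : ∀ j : Fin n, ∀ k : ℕ, (j : ℕ) + 1 ≤ k → k ≤ n → ∀ i, j < i → W k i j = 0 := by
    intro j k hjk hk i hi
    rw [hfrozen j hjk hk, (hstep j).2.2.2.2.1 i, if_neg (not_lt.2 hi.le), if_neg hi.ne']
  have hex := fun k : Fin n => exists_reflection_of_step hε hεη hη1 hpow
    (fun j hj i hi => hzero j k hj k.2.le i hi) ((hstep k).1 k le_rfl) (hstep k).2.2.1
    (hstep k).2.2.2.1 (hstep k).2.2.2.2.1 (hstep k).2.2.2.2.2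
  choose M hM hMM hrefl hcol using hex
  obtain ⟨P, hP0, hP, hPu⟩ := exists_partial_products hM
  refine ⟨P n, hPu n, fun i j hij => ?_, fun j => ?_, fun Q hQ j => ?_, fun D X hX j => ?_,
    fun i j hij => ?_⟩
  · rw [← hWn]
    exact hzero j n (Nat.succ_le_of_lt j.2) le_rfl i hij
  · have := l2_mulVec_sub_le_of_forward hMM hP0 hP hPu hh0 (fun k i => W k i j)
      (fun k => hcol k j)
    simp only [hWn, hW0] at this
    exact this.trans (mul_le_mul_of_nonneg_right hpow2 (l2_nonneg _))
  · obtain ⟨G, hGn, hG0, hG⟩ := hQ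
    have := l2_sub_mulVec_le_of_backward hP0 hP hPu hh0 (fun k i => G k i j)
      (fun k => hrefl k _ _ (hG k j))
    simp only [hGn, hG0] at this
    have h1 : (fun i => (1 : Matrix (Fin n) (Fin n) 𝕜) i j) = Pi.single j 1 := by
      funext i
      rw [one_apply, Pi.single_apply]
    have h2 : l2 (Pi.single j 1 : Fin n → 𝕜) = 1 := by
      simp [l2]
    rw [h1, h2, mul_one, mulVec_single_one] at this
    exact this.trans hpow2
  · obtain ⟨Z, hZ0, hZn, hZ⟩ := hX
    have := l2_mulVec_sub_le_of_forward hMM hP0 hP hPu hh0 (fun k i => Z k i j)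
      (fun k => hrefl k _ _ (hZ k j))
    simp only [hZn, hZ0] at this
    exact this.trans (mul_le_mul_of_nonneg_right hpow2 (l2_nonneg _))
  · have hcard : (1 + ε) ^ (Finset.Ici i).card - 1 ≤ η := by
      have h1 : (Finset.Ici i).card ≤ n := by simp
      have := pow_le_pow_right₀ (show (1 : ℝ) ≤ 1 + ε by linarith) h1
      linarith
    -- Dominance holds up to rounding when pivot `i` is chosen; from then on the rows from `i` on
    -- only undergo the reflections of steps `k ≥ i`, which nearly preserve their norm.
    have hgrow := l2_le_pow_mul_of_step hh0 (z := fun k => l2 (lowerPart i fun l => W k l j))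
      i.2.le fun k hik hk => l2_lowerPart_le_of_step hε hεη hη1 hpow (k := ⟨k, hk⟩) hik
        ((hstep ⟨k, hk⟩).1 _ le_rfl) (hstep ⟨k, hk⟩).2.2.1
        (hstep ⟨k, hk⟩).2.2.2.1 (hstep ⟨k, hk⟩).2.2.2.2.1 (hstep ⟨k, hk⟩).2.2.2.2.2 j
    simp only [hWn] at hgrow
    have hpow3 : (1 + 170 * η) ^ (n - (i : ℕ)) ≤ 1 + 680 * ((n : ℝ) ^ 3 * ε) := by
      have := pow_le_pow_right₀ (show (1 : ℝ) ≤ 1 + 170 * η by linarith) (Nat.sub_le n i)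
      linarith
    have hRii : ‖σ i‖ = ‖R i i‖ := by
      rw [← hWn, hfrozen i (Nat.succ_le_of_lt i.2) le_rfl, (hstep i).2.2.2.2.1 i]
      simp
    have hνj := (((hstep i).1 j hij).nonneg_and_fl hε hεη (by linarith) hcard)
    have hνi := (((hstep i).1 i le_rfl).nonneg_and_fl hε hεη (by linarith) hcard)
    rw [← l2_lowerPart_eq] at hνj hνi
    have h1 := hνj.2.le_norm
    have h2 := hνi.2.norm_le
    rw [Real.norm_of_nonneg (l2_nonneg _), Real.norm_of_nonneg hνj.1] at h1
    rw [Real.norm_of_nonneg (l2_nonneg _), Real.norm_of_nonneg hνi.1] at h2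
    have h3 := (hstep i).2.1 j hij
    obtain ⟨-, -, -, -, -, -, h4⟩ :=
      exists_exact_reflection hε hεη hη1 hpow ((hstep i).1 i le_rfl) (hstep i).2.2.1
    rw [hRii] at h4
    set a := l2 (lowerPart i fun l => W i l j)
    set b := l2 (lowerPart i fun l => W i l i)
    have ha : 0 ≤ a := l2_nonneg _
    have hb : 0 ≤ b := l2_nonneg _
    have hr := norm_nonneg (R i i)
    have h5 : b ≤ (1 + 11 * η) * ‖R i i‖ := by
      have : (1 + 11 * η) * ((1 - 10 * η) * b) ≤ (1 + 11 * η) * ‖R i i‖ :=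
        mul_le_mul_of_nonneg_left h4 (by linarith)
      nlinarith [mul_nonneg hη0 hb, mul_nonneg hη0 (mul_nonneg hη0 hb)]
    have h6 : a ≤ (1 + 7 * η) * b := by
      have : (1 + 3.5 * η) * ((1 - 3 * η) * a) ≤ (1 + 3.5 * η) * ((1 + 3 * η) * b) :=
        mul_le_mul_of_nonneg_left (by linarith) (by linarith)
      -- The chain `(1 - 3η) a ≤ ν_j ≤ ν_i ≤ (1 + 3η) b` is where the pivoting enters.
      nlinarith [mul_nonneg hη0 hb, mul_nonneg hη0 ha, mul_nonneg hη0 (mul_nonneg hη0 hb)]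
    have h7 : a ≤ (1 + 20 * η) * ‖R i i‖ := by
      have := mul_le_mul_of_nonneg_left h5 (show 0 ≤ 1 + 7 * η by linarith)
      have h8 : (1 + 7 * η) * (1 + 11 * η) ≤ 1 + 20 * η := by nlinarith
      have := mul_le_mul_of_nonneg_right h8 hr
      linarith
    set t := (n : ℝ) ^ 3 * ε
    have ht0 : 0 ≤ t := by positivity
    have h8 : a ≤ (1 + 40 * t) * ‖R i i‖ :=
      h7.trans (mul_le_mul_of_nonneg_right (by linarith) hr)
    have h9 : (1 + 680 * t) * (1 + 40 * t) ≤ 1 + 800 * t := by nlinarith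
    calc _ ≤ _ := hgrow
      _ ≤ (1 + 680 * t) * ((1 + 40 * t) * ‖R i i‖) := mul_le_mul hpow3 h8 ha (by linarith)
      _ = (1 + 680 * t) * (1 + 40 * t) * ‖R i i‖ := by ring
      _ ≤ _ := mul_le_mul_of_nonneg_right h9 hr

end ErrorAnalysis

/-! ### Exact deflation of the zero eigenvalues -/

section Deflation

open Matrix

variable {𝕜 : Type*} [RCLike 𝕜] {n r : ℕ}

theorem firstCols_mul_firstRows_apply (hr : r ≤ n) (R : Matrix (Fin n) (Fin n) 𝕜) (i j : Fin n) :
    (firstCols 𝕜 hr * firstRows hr R) i j = if (i : ℕ) < r then R i j else 0 := by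
  have h1 : (firstCols 𝕜 hr * firstRows hr R) i j
      = ∑ b : Fin r, if i = Fin.castLE hr b then R (Fin.castLE hr b) j else 0 := by
    simp [firstCols, firstRows, mul_apply, one_apply]
  rw [h1]
  split_ifs with hi
  · have h2 := Fintype.sum_eq_single (⟨i, hi⟩ : Fin r)
      (f := fun b => if i = Fin.castLE hr b then R (Fin.castLE hr b) j else 0)
      fun b hb => if_neg fun h : i = _ => hb (Fin.ext (congrArg Fin.val h).symm)
    exact h2.trans (if_pos (Fin.ext rfl))
  · refine Finset.sum_eq_zero fun b _ => if_neg ?_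
    rintro rfl
    exact hi b.2

/-- The leading `r × r` block is triangular with nonzero diagonal, hence invertible; only `r` rows
are nonzero. -/
theorem rank_firstCols_mul_firstRows (hr : r ≤ n) {R : Matrix (Fin n) (Fin n) 𝕜}
    (hR : ∀ i j, j < i → R i j = 0) (hd : ∀ i : Fin n, (i : ℕ) < r → R i i ≠ 0) :
    (firstCols 𝕜 hr * firstRows hr R).rank = r := by
  refine le_antisymm ((rank_mul_le_right _ _).trans
    ((rank_le_card_height _).trans_eq (Fintype.card_fin r))) ?_
  set T : Matrix (Fin r) (Fin r) 𝕜 := R.submatrix (Fin.castLE hr) (Fin.castLE hr) with hT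
  have hTdet : IsUnit T.det := by
    rw [det_of_isUpperTriangular (M := T) (fun i j hij => hR _ _ hij), isUnit_iff_ne_zero]
    exact Finset.prod_ne_zero_iff.2 fun i _ => hd _ i.2
  have hTrank : T.rank = r := by
    rw [rank_of_isUnit T ((isUnit_iff_isUnit_det T).2 hTdet), Fintype.card_fin]
  have h1 : (firstCols 𝕜 hr * firstRows hr R).submatrix (Fin.castLE hr) (Fin.castLE hr) = T := by
    ext i j
    rw [submatrix_apply, firstCols_mul_firstRows_apply]
    exact if_pos i.2
  calc r = T.rank := hTrank.symm
    _ ≤ _ := by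
      rw [← h1]
      exact rank_submatrix_le _ _ _

theorem quartic_map_eval_zero (A B C D E : Matrix (Fin n) (Fin n) 𝕜) :
    (quartic A B C D E).map (Polynomial.eval 0) = E := by
  ext i j
  simp [quartic]

/-- The last `n - r` rows of `Pᴴ` times the polynomial vanish at zero, so a factor `λ` can be taken
out of each; the geometric count is rank-nullity for `E`. -/
theorem hasAtLeastZeroEigenvalues_quartic (hr : r ≤ n) {A B C D E P : Matrix (Fin n) (Fin n) 𝕜}
    (hP : P ∈ unitaryGroup (Fin n) 𝕜) (hE : ∀ i j : Fin n, r ≤ (i : ℕ) → (Pᴴ * E) i j = 0)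
    (hrank : E.rank = r) : HasAtLeastZeroEigenvalues (n - r) (quartic A B C D E) := by
  have hPP : P * Pᴴ = 1 := mem_unitaryGroup_iff.1 hP
  set q := quartic A B C D E with hq
  have hq0 : q.map (Polynomial.eval 0) = E := quartic_map_eval_zero A B C D E
  constructor
  · set N := Pᴴ.map Polynomial.C * q with hN
    have hN0 : N.map (Polynomial.eval 0) = Pᴴ * E := by
      have h1 := Matrix.map_mul (L := Pᴴ.map Polynomial.C) (M := q)
        (f := Polynomial.evalRingHom (0 : 𝕜))
      simp only [Polynomial.coe_evalRingHom] at h1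
      rw [hN, h1, hq0]
      congr 1
      ext i j
      simp
    have hdvd : ∀ i j, ∃ p, N i j = (if r ≤ (i : ℕ) then Polynomial.X else 1) * p := by
      intro i j
      split_ifs with hi
      · refine Polynomial.X_dvd_iff.2 ?_
        rw [Polynomial.coeff_zero_eq_eval_zero]
        have := congrFun (congrFun hN0 i) j
        rw [hE i j hi] at this
        exact this
      · exact ⟨N i j, (one_mul _).symm⟩
    choose N' hN' using hdvd
    have h2 : N = diagonal (fun i : Fin n => if r ≤ (i : ℕ) then (Polynomial.X : 𝕜[X]) else 1)
        * of N' := by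
      ext1 i j
      rw [diagonal_mul, hN' i j, of_apply]
    have h3 : q = P.map Polynomial.C * N := by
      rw [hN, ← mul_assoc, ← Matrix.map_mul, hPP]
      simp
    have h4 : (Finset.univ.filter fun i : Fin n => r ≤ (i : ℕ)).card = n - r := by
      rcases hr.eq_or_lt with h | h
      · subst h
        rw [Nat.sub_self, Finset.card_eq_zero]
        exact Finset.filter_eq_empty_iff.2 fun i _ => not_le.2 i.2
      · rw [← Fin.card_Ici ⟨r, h⟩]
        congr 1
        ext i
        simp [Fin.le_def]
    rw [h3, det_mul, h2, det_mul, det_diagonal, Finset.prod_ite, Finset.prod_const, h4, mul_assoc]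
    exact Dvd.dvd.mul_left (Dvd.intro _ rfl) _
  · rw [hq0]
    have h1 := LinearMap.finrank_range_add_finrank_ker (toLin' E)
    rw [Module.finrank_fin_fun] at h1
    have h2 : Module.finrank 𝕜 (LinearMap.range (toLin' E)) = r := by
      rw [← hrank, Matrix.rank, toLin'_apply']
    omega

theorem isExactReducedLinearization_of_unitary (hr : r ≤ n) (A B X Y : Matrix (Fin n) (Fin n) 𝕜)
    {E P R : Matrix (Fin n) (Fin n) 𝕜} {π : Equiv.Perm (Fin n)}
    (hP : P ∈ unitaryGroup (Fin n) 𝕜)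
    (hR : ∀ i j, j < i → R i j = 0) (hd : ∀ i : Fin n, (i : ℕ) < r → R i i ≠ 0)
    (hE : E = P * (firstCols 𝕜 hr * firstRows hr R).submatrix id π.symm) :
    IsExactReducedLinearization hr A B (P * Y) (P * X) E π P (firstRows hr R)
      (redA hr B X (firstRows hr R) π) (redB r A Y P) ∧
    HasAtLeastZeroEigenvalues (n - r) (quartic A B (P * Y) (P * X) E) := by
  have hPP : Pᴴ * P = 1 := mem_unitaryGroup_iff'.1 hP
  have hcancel : ∀ M : Matrix (Fin n) (Fin n) 𝕜, Pᴴ * (P * M) = M := fun M => by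
    rw [← mul_assoc, hPP, one_mul]
  have hPE : Pᴴ * E = (firstCols 𝕜 hr * firstRows hr R).submatrix id π.symm := by
    rw [hE, hcancel]
  have hrank : E.rank = r := by
    have hPdet : IsUnit P.det := by
      have := congrArg det hPP
      rw [det_mul, det_one] at this
      exact IsUnit.of_mul_eq_one_right _ this
    rw [hE, rank_mul_eq_right_of_isUnit_det _ _ hPdet]
    exact (rank_submatrix _ (Equiv.refl _) π.symm).trans (rank_firstCols_mul_firstRows hr hR hd)
  refine ⟨⟨hP, fun i j hij => hR _ _ hij, hrank, ?_, ?_⟩,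
    hasAtLeastZeroEigenvalues_quartic hr hP (fun i j hi => ?_) hrank⟩
  · rw [hE]
    ext i j
    simp [mul_apply]
  · have hA : transL P * linA B (P * X) E * transR P = fromBlocks (fromBlocks B 0 X 0) (-1)
        (fromBlocks 0 (-1) ((firstCols 𝕜 hr * firstRows hr R).submatrix id π.symm) 0) 0 := by
      simp [transL, linA, transR, fromBlocks_multiply, hcancel, hPE, hPP, ← fromBlocks_one,
        fromBlocks_neg]
    have hB : transL P * linB A (P * Y) * transR P =
        fromBlocks (fromBlocks (-A) 0 (-Y) (-Pᴴ)) 0 0 (-1) := by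
      simp [transL, linB, transR, fromBlocks_multiply, hcancel, hPP, ← fromBlocks_one,
        fromBlocks_neg]
    have hF := firstCols_mul_firstRows_apply hr R
    generalize firstCols 𝕜 hr * firstRows hr R = F at hA hF
    -- The coupling block consists of the last `n - r` columns of the block `-I` in the second block
    -- row; the right coefficient has no coupling.
    refine ⟨fromRows (fromRows 0 (-((1 : Matrix (Fin n) (Fin n) 𝕜).submatrix id
      fun j : Fin (n - r) => finCongr (Nat.add_sub_of_le hr) (Fin.natAdd r j)))) 0, 0, ?_, ?_⟩
    · rw [hA]
      ext1 i j
      rcases i with ((i | i) | (i | i)) | i <;> rcases j with ((j | j) | (j | j)) | j <;>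
        simp [splitIdx, redA, firstCols, firstRows, one_apply, Fin.ext_iff, hF]
      rfl
    · rw [hB]
      ext1 i j
      rcases i with ((i | i) | (i | i)) | i <;> rcases j with ((j | j) | (j | j)) | j <;>
        simp [splitIdx, redB, one_apply, Fin.ext_iff]
      · omega
      · omega
  · rw [hPE, submatrix_apply, firstCols_mul_firstRows_apply]
    exact if_neg (not_lt.2 hi)

end Deflation

/-! ### Columnwise bounds and the truncation error -/

section BackwardErrors

open Matrix

variable {𝕜 : Type*} [RCLike 𝕜] {n r : ℕ}

theorem colNorm_eq_l2 (M : Matrix (Fin n) (Fin n) 𝕜) (j : Fin n) :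
    colNorm M j = l2 fun i => M i j := (l2_eq _).symm

theorem frobNorm_le_of_colNorm_le {M : Matrix (Fin n) (Fin n) 𝕜} {h : ℝ} (h0 : 0 ≤ h)
    (H : ∀ j, colNorm M j ≤ h) : frobNorm M ≤ n * h := by
  have h1 : frobNorm M = l2 (colNorm M) := by
    rw [l2_eq, frobNorm, Finset.sum_comm]
    congr 1
    refine Finset.sum_congr rfl fun j _ => ?_
    rw [colNorm_eq_l2, Real.norm_of_nonneg (l2_nonneg _), l2_sq]
  rw [h1]
  refine l2_le_card_mul h0 fun j => ?_
  rw [Real.norm_of_nonneg (show 0 ≤ colNorm M j from Real.sqrt_nonneg _)]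
  exact H j

theorem colNorm_unitary_mul {P : Matrix (Fin n) (Fin n) 𝕜} (hP : P ∈ unitaryGroup (Fin n) 𝕜)
    (M : Matrix (Fin n) (Fin n) 𝕜) (j : Fin n) : colNorm (P * M) j = colNorm M j := by
  rw [colNorm_eq_l2, colNorm_eq_l2, ← l2_mulVec_of_mem_unitaryGroup hP (fun i => M i j)]
  rfl

/-- Each entry of `X - Pᴴ D` has a rounding error, with columns of `Q` of norm at most `2`, and an
error from `Q - P`. The factor `n` passes from entries to columns. -/
theorem IsMatMulProduct.colNorm_sub_le {ε h : ℝ} (hε : 0 ≤ ε) (hnε : n * ε ≤ 1) (h0 : 0 ≤ h)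
    (h1 : h ≤ 1) {P Q D X : Matrix (Fin n) (Fin n) 𝕜} (hP : P ∈ unitaryGroup (Fin n) 𝕜)
    (hQ : ∀ j, colNorm (Q - P) j ≤ h) (H : IsMatMulProduct ε Q D X) (j : Fin n) :
    colNorm (P * X - D) j ≤ n * (4 * n * ε + h) * colNorm D j := by
  have hPP : P * Pᴴ = 1 := mem_unitaryGroup_iff.1 hP
  have e : P * X - D = P * (X - Pᴴ * D) := by
    rw [mul_sub, ← mul_assoc, hPP, one_mul]
  have hQ2 : ∀ i, l2 (fun l => Q l i) ≤ 2 := fun i => by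
    have h2 := l2_add_le (fun l => (Q - P) l i) (fun l => P l i)
    have h3 : l2 (fun l => P l i) = 1 := by
      have h4 : l2 (fun l => P l i) ^ 2 = 1 := by
        have h5 := star_dotProduct_self (fun l => P l i)
        have h6 : star (fun l => P l i) ⬝ᵥ (fun l => P l i) = (Pᴴ * P) i i := rfl
        rw [h6, show Pᴴ * P = 1 from mem_unitaryGroup_iff'.1 hP, one_apply_eq] at h5
        exact_mod_cast h5.symm
      exact (pow_eq_one_iff_of_nonneg (l2_nonneg _) two_ne_zero).1 h4
    have h4 : ((fun l => (Q - P) l i) + fun l => P l i) = fun l => Q l i := by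
      funext l; simp
    rw [h4, h3, ← colNorm_eq_l2 (Q - P)] at h2
    linarith [hQ i]
  rw [e, colNorm_unitary_mul hP, colNorm_eq_l2, colNorm_eq_l2, mul_assoc]
  have hD0 := l2_nonneg fun i => D i j
  refine l2_le_card_mul (by positivity) fun i => ?_
  have h2 := (H i j).norm_sub_le hε
  rw [Finset.card_univ, Fintype.card_fin] at h2
  simp only [norm_star] at h2
  have h3 := mul_le_mul (one_add_pow_sub_one_le hε hnε)
    ((sum_norm_mul_norm_le Finset.univ (fun l => Q l i) fun l => D l j).trans
      (mul_le_mul_of_nonneg_right (hQ2 i) hD0))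
    (Finset.sum_nonneg fun _ _ => by positivity) (by positivity)
  have h4 := (norm_star_dotProduct_le (fun l => (Q - P) l i) fun l => D l j).trans
    (mul_le_mul_of_nonneg_right ((colNorm_eq_l2 (Q - P) i).symm.trans_le (hQ i)) hD0)
  have h5 : (X - Pᴴ * D) i j = (X i j - ∑ l, star (Q l i) * D l j)
      + star (fun l => (Q - P) l i) ⬝ᵥ fun l => D l j := by
    simp only [Matrix.sub_apply, mul_apply, conjTranspose_apply, dotProduct, Pi.star_apply, star_sub,
      sub_mul, Finset.sum_sub_distrib]
    ring
  rw [h5]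
  refine (norm_add_le _ _).trans ?_
  linarith

theorem IsDiagDominant.l2_lowerPart_le {R : Matrix (Fin n) (Fin n) 𝕜} (H : IsDiagDominant R)
    (hR : ∀ i j, j < i → R i j = 0) {i j : Fin n} (hij : i ≤ j) :
    l2 (lowerPart i fun l => R l j) ≤ ‖R i i‖ := by
  rw [l2_lowerPart_eq]
  refine Real.sqrt_le_iff.2 ⟨norm_nonneg _, le_of_eq_of_le ?_ (H i j hij)⟩
  refine (Finset.sum_subset (fun l hl => Finset.mem_Ici.2 (Finset.mem_Icc.1 hl).1)
    fun l hl hl' => ?_).symm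
  have : j < l := not_le.1 fun h => hl' (Finset.mem_Icc.2 ⟨Finset.mem_Ici.1 hl, h⟩)
  rw [hR l j this]
  simp

/-- The sign of `τ` is not assumed; a drop-off below a nonzero diagonal entry forces it. -/
theorem IsNumericalRank.threshold_nonneg {τ : ℝ} {R : Matrix (Fin n) (Fin n) 𝕜}
    (hrank : IsNumericalRank τ R r) (h0 : r ≠ 0) (hr : r < n) : 0 ≤ τ := by
  obtain ⟨-, hne, hdrop, -⟩ := hrank
  have hpos : 0 < ‖R ⟨r - 1, by omega⟩ ⟨r - 1, by omega⟩‖ :=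
    norm_pos_iff.2 (hne ⟨r - 1, by omega⟩ (by simp; omega))
  have hdrop := hdrop ⟨r - 1, by omega⟩ ⟨r, hr⟩ (by simp; omega) rfl
  by_contra! h
  have := mul_neg_of_neg_of_pos h hpos
  linarith [norm_nonneg (R ⟨r, hr⟩ ⟨r, hr⟩)]

/-- Dominance is used twice, for the discarded part of column `j` and for the last retained diagonal
entry against `R i i`, hence `κ ^ 2`. Taking `κ = 1` covers exact dominance. -/
theorem colNorm_truncation_le {κ τ : ℝ} (hκ : 0 ≤ κ) (hr : r ≤ n) {R : Matrix (Fin n) (Fin n) 𝕜}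
    (hrank : IsNumericalRank τ R r)
    (hdom : ∀ i j, i ≤ j → l2 (lowerPart i fun l => R l j) ≤ κ * ‖R i i‖) {i j : Fin n}
    (hi : (i : ℕ) < r) (hj : r ≤ (j : ℕ)) :
    colNorm (firstCols 𝕜 hr * firstRows hr R - R) j ≤ κ ^ 2 * τ * colNorm R i := by
  have hτ := hrank.threshold_nonneg (by omega) (by omega)
  obtain ⟨-, hne, hdrop, -⟩ := hrank
  obtain ⟨p, hp⟩ : ∃ p : Fin n, (p : ℕ) + 1 = r := ⟨⟨r - 1, by omega⟩, by simp; omega⟩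
  obtain ⟨q, hq⟩ : ∃ q : Fin n, (q : ℕ) = r := ⟨⟨r, by omega⟩, rfl⟩
  have hdrop := hdrop p q hp hq
  have h1 : colNorm (firstCols 𝕜 hr * firstRows hr R - R) j
      ≤ l2 (lowerPart q fun l => R l j) := by
    rw [colNorm_eq_l2, ← one_mul (l2 (lowerPart q _))]
    refine l2_le_mul_of_norm_le zero_le_one fun l => ?_
    rw [Matrix.sub_apply, firstCols_mul_firstRows_apply, lowerPart]
    by_cases hl : (l : ℕ) < r
    · simp [hl]
    · simp [hl, Fin.lt_def, hq]
  have hip : i ≤ p := Fin.le_def.2 (by omega)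
  have h2 : ‖R p p‖ ≤ κ * ‖R i i‖ := by
    refine le_trans ?_ (hdom i p hip)
    have := norm_le_l2 (lowerPart i fun l => R l p) p
    rwa [lowerPart, if_neg (not_lt.2 hip)] at this
  have h3 : ‖R i i‖ ≤ colNorm R i := by
    rw [colNorm_eq_l2]
    exact norm_le_l2 (fun l => R l i) i
  calc _ ≤ _ := h1
    _ ≤ κ * ‖R q q‖ := hdom q j (Fin.le_def.2 (by omega))
    _ ≤ κ * (τ * (κ * colNorm R i)) := by
      gcongr
      exact hdrop.trans (by gcongr; exact h2.trans (by gcongr))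
    _ = _ := by ring

end BackwardErrors

/-! ### The main theorem -/

theorem proposition1 (𝕜 : Type*) [RCLike 𝕜] :
    ∃ c : ℝ, 0 < c ∧
    ∀ (n : ℕ) (ε τ : ℝ), 0 ≤ ε → c * (n : ℝ) ^ 3 * ε ≤ 1 →
    ∀ (A B C D E : Matrix (Fin n) (Fin n) 𝕜)
      (π : Equiv.Perm (Fin n)) (v : Fin n → Fin n → 𝕜) (β : Fin n → ℝ)
      (Q R X Y : Matrix (Fin n) (Fin n) 𝕜) (r : ℕ) (hr : r ≤ n),
      IsPivotedQR ε E π v β R → IsFormedQ ε v β Q → IsNumericalRank τ R r →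
      IsComputedProduct ε v β Q D X → IsComputedProduct ε v β Q C Y →
    ∃ δQ δC δD δE ΔE : Matrix (Fin n) (Fin n) 𝕜,
      IsExactReducedLinearization hr A B (C + δC) (D + δD) (E + δE + ΔE)
        π (Q + δQ) (firstRows hr R)
        (redA hr B X (firstRows hr R) π) (redB r A Y Q + deltaRedB r δQ) ∧
      HasAtLeastZeroEigenvalues (n - r) (quartic A B (C + δC) (D + δD) (E + δE + ΔE)) ∧
      frobNorm δQ ≤ c * (n : ℝ) ^ 3 * ε ∧
      (∀ i, colNorm δC i ≤ c * (n : ℝ) ^ 3 * ε * colNorm C i) ∧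
      (∀ i, colNorm δD i ≤ c * (n : ℝ) ^ 3 * ε * colNorm D i) ∧
      (∀ i, colNorm δE i ≤ c * (n : ℝ) ^ 3 * ε * colNorm E i) ∧
      (∀ j : Fin n, (j : ℕ) < r → ∀ i, ΔE i (π j) = 0) ∧
      (∀ i j : Fin n, (i : ℕ) < r → r ≤ (j : ℕ) →
        colNorm ΔE (π j) ≤ (1 + c * (n : ℝ) ^ 3 * ε) * τ * colNorm (E + δE) (π i)) ∧
      (IsDiagDominant R → ∀ i j : Fin n, (i : ℕ) < r → r ≤ (j : ℕ) →
        colNorm ΔE (π j) ≤ τ * colNorm (E + δE) (π i)) ∧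
      (r = 0 → ΔE = 0) := by
  -- The constant is generous: products need `684`, and squaring `1 + 800 * t` needs less than
  -- `1700`, given `10000 * t ≤ 1`.
  refine ⟨10000, by norm_num, ?_⟩
  intro n ε τ hε hc A B C D E π v β Q R X Y r hr hqr hQ hrank hX hY
  obtain ⟨P, hP, hR, hE, hPQ, hprod, hdom⟩ := hqr.exists_unitary hε hc
  replace hPQ := hPQ Q hQ
  set t := (n : ℝ) ^ 3 * ε with ht
  have ht0 : 0 ≤ t := by positivity
  have hc' : 10000 * (n : ℝ) ^ 3 * ε = 10000 * t := by rw [ht]; ring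
  rw [hc'] at hc ⊢
  have hnε : (n : ℝ) * ε ≤ t := mul_le_mul_of_nonneg_right
    (by exact_mod_cast Nat.le_self_pow (show 3 ≠ 0 by norm_num) n) hε
  have hn2 : (n : ℝ) ^ 2 ≤ (n : ℝ) ^ 3 := by
    rcases Nat.eq_zero_or_pos n with rfl | h
    · simp
    · exact_mod_cast Nat.pow_le_pow_right h (by norm_num)
  have hn2ε : (n : ℝ) ^ 2 * ε ≤ t := mul_le_mul_of_nonneg_right hn2 hε
  have hn2ε0 : 0 ≤ (n : ℝ) ^ 2 * ε := by positivity
  have hQP : ∀ j, colNorm (Q - P) j ≤ 680 * (n : ℝ) ^ 2 * ε := fun j => by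
    rw [colNorm_eq_l2]; exact hPQ j
  have hcomp : ∀ D X, IsComputedProduct ε v β Q D X → ∀ j,
      colNorm (P * X - D) j ≤ 10000 * t * colNorm D j := by
    intro D X h j
    have hD0 : 0 ≤ colNorm D j := Real.sqrt_nonneg _
    rcases h with h | h
    · refine (h.colNorm_sub_le hε (by linarith) (by linarith) (by linarith) hP hQP j).trans
        (mul_le_mul_of_nonneg_right ?_ hD0)
      have : (n : ℝ) * (4 * n * ε + 680 * (n : ℝ) ^ 2 * ε) = 4 * ((n : ℝ) ^ 2 * ε) + 680 * t := by
        rw [ht]; ring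
      linarith
    · rw [colNorm_eq_l2 D] at hD0 ⊢
      rw [colNorm_eq_l2]
      exact (hprod D X h j).trans (mul_le_mul_of_nonneg_right (by linarith) hD0)
  have hEsum : ∀ F : Matrix (Fin n) (Fin n) 𝕜, E + (P * R.submatrix id π.symm - E)
      + P * (F - R).submatrix id π.symm = P * F.submatrix id π.symm := fun F => by
    rw [add_sub_cancel, ← mul_add]
    congr 1
    ext i j
    simp
  have hcolΔ : ∀ (M : Matrix (Fin n) (Fin n) 𝕜) j,
      colNorm (P * M.submatrix id π.symm) (π j) = colNorm M j := fun M j => by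
    rw [colNorm_unitary_mul hP, colNorm, colNorm]
    simp
  obtain ⟨hlin, hzero⟩ := isExactReducedLinearization_of_unitary hr A B X Y hP hR hrank.2.1
    (π := π) (hEsum (firstCols 𝕜 hr * firstRows hr R))
  -- Each perturbation is the defect of a computed quantity with respect to `P`; `ΔE` alone carries
  -- the truncation of `R`.
  refine ⟨P - Q, P * Y - C, P * X - D, P * R.submatrix id π.symm - E,
    P * (firstCols 𝕜 hr * firstRows hr R - R).submatrix id π.symm, ?_, ?_, ?_,
    hcomp C Y hY, hcomp D X hX, fun i => ?_, fun j hj i => ?_, fun i j hi hj => ?_,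
    fun hd i j hi hj => ?_, fun h0 => ?_⟩
  · have hB : redB r A Y Q + deltaRedB r (P - Q) = redB r A Y P := by
      rw [redB, deltaRedB, Matrix.fromBlocks_add, Matrix.fromBlocks_add, ← neg_add,
        ← Matrix.conjTranspose_add, add_sub_cancel]
      simp [redB]
    rwa [add_sub_cancel C, add_sub_cancel D, add_sub_cancel Q, hB]
  · rwa [add_sub_cancel C, add_sub_cancel D]
  · refine (frobNorm_le_of_colNorm_le (h := 680 * (n : ℝ) ^ 2 * ε) (by positivity) fun j => ?_).trans
      ?_
    · have h1 : colNorm (P - Q) j = colNorm (Q - P) j := by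
        simp only [colNorm, Matrix.sub_apply, norm_sub_rev]
      rw [h1]
      exact hQP j
    · have : (n : ℝ) * (680 * (n : ℝ) ^ 2 * ε) = 680 * t := by rw [ht]; ring
      linarith
  · have h1 := hE (π.symm i)
    rw [Equiv.apply_symm_apply] at h1
    rw [colNorm_eq_l2, colNorm_eq_l2]
    exact h1.trans (mul_le_mul_of_nonneg_right (by linarith) (l2_nonneg _))
  · have h1 : ∀ l, (firstCols 𝕜 hr * firstRows hr R - R) l j = 0 := fun l => by
      rw [Matrix.sub_apply, firstCols_mul_firstRows_apply]
      split_ifs with hl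
      · exact sub_self _
      · rw [hR l j (Fin.lt_def.2 (by omega)), sub_self]
    simp only [Matrix.mul_apply, Matrix.submatrix_apply, Equiv.symm_apply_apply, id, h1, mul_zero,
      Finset.sum_const_zero]
  · rw [add_sub_cancel, hcolΔ, hcolΔ]
    have h1 := colNorm_truncation_le (by linarith) hr hrank hdom hi hj
    have h2 : (1 + 800 * t) ^ 2 ≤ 1 + 10000 * t := by nlinarith
    have h3 := hrank.threshold_nonneg (by omega) (hj.trans_lt j.2)
    refine h1.trans (mul_le_mul_of_nonneg_right (mul_le_mul_of_nonneg_right h2 h3) ?_)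
    exact Real.sqrt_nonneg _
  · rw [add_sub_cancel, hcolΔ, hcolΔ]
    have := colNorm_truncation_le zero_le_one hr hrank
      (fun i j hij => by simpa using hd.l2_lowerPart_le hR hij) hi hj
    simpa using this
  -- If the first pivot vanishes, approximate dominance in the first row forces all of `R` to
  -- vanish, and nothing is truncated.
  · have hR0 : R = 0 := by
      ext i j
      have hpos : 0 < n := i.pos
      have h1 := hdom ⟨0, hpos⟩ j (Fin.le_def.2 (Nat.zero_le _))
      rw [hrank.2.2.2 h0 ⟨0, hpos⟩ rfl, norm_zero, mul_zero] at h1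
      have h2 := norm_le_l2 (lowerPart ⟨0, hpos⟩ fun l => R l j) i
      rw [lowerPart, if_neg (not_lt.2 (Fin.le_def.2 (Nat.zero_le _)))] at h2
      exact norm_le_zero_iff.1 (h2.trans h1)
    have h1 : firstRows hr R = 0 := by rw [hR0]; rfl
    rw [h1, hR0]
    simp
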